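/- Setting. Let $d\in\{2,3\}$ and let $D\subset\mathbb R^d$ be a polytopal domain. Let $\kappa:D\to\mathbb R$ be measurable with $0<\kappa_{\min}\le\kappa\le\kappa_{\max}$ a.e., and let $f\in L^2(D)$ with $\int_D f\,dx=0$. Put $a(v,w)=\int_D\kappa^{-1}v\cdot w\,dx$, $\|v\|_a=a(v,v)^{1/2}$ and $b(w,q)=\int_D q\,\nabla\cdot w\,dx$. Let $\mathcal T^H$ be a partition of $D$ into finitely many closed convex polytopes $K$ (with non-empty, pairwise disjoint interiors), and let $\mathcal T^h$ be such a partition refining it. Let $Q_H$ be the space of mean-zero functions in $L^2(D)$ that are constant on every $K\in\mathcal T^H$. Let $\{E_\ell\}$ be the interior faces of $\mathcal T^H$, let $m_\ell$ be a fixed unit normal of $E_\ell$, and let $\omega_\ell=\bigcup\{K\in\mathcal T^H:E_\ell\subset K\}$. Snapshots. For every fine face $e_j\subset E_\ell$ let $\delta_j^\ell$ be the function on $E_\ell$ equal to $|e_j|^{-1}$ on $e_j$ and to $0$ on the other fine faces. Let $(\psi_{\rm snap}^{\ell,j},p_{\rm snap}^{\ell,j})$ be the weak solution of $\kappa^{-1}\psi+\nabla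 p=0$ and $\nabla\cdot\psi=\alpha_K$ in each $K\subset\omega_\ell$, $\psi\cdot m_\ell=\delta_j^\ell$ on $E_\ell$, $\psi\cdot n=0$ on $\partial\omega_\ell\setminus E_\ell$, with $\int_K p\,dx=0$ for each $K\subset\omega_\ell$. Here $\psi$ is extended by zero to $D$, and $\alpha_K=\pm|K|^{-1}\int_{E_\ell}\delta_j^\ell\,dS$, with $+$ if $m_\ell$ points out of $K$ and $-$ otherwise. Let $V_{\rm snap}^{(\ell)}=\operatorname{span}_j\{\psi_{\rm snap}^{\ell,j}\}$ and $V_{\rm snap}=\bigoplus_\ell V_{\rm snap}^{(\ell)}$. Let $V_{{\rm snap},1}^{(\ell)}$ be spanned by the $\varphi\in V_{\rm snap}^{(\ell)}$ with $\varphi\cdot m_\ell=1$ on $E_\ell$, and let $V_{{\rm snap},2}^{(\ell)}=\{v\in V_{\rm snap}^{(\ell)}:\int_{E_\ell}v\cdot m_\ell\,dS=0\}$. Offline space. For $v\in V_{{\rm snap},2}^{(\ell)}$ let $\mathcal H_\ell(v)$ be the minimizer of $\int_{\omega_\ell}\kappa^{-1}|w|^2dx$ over the restrictions $w$ to $\omega_\ell$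 of elements of $V_{\rm snap}$ with $w\cdot m_\ell=v\cdot m_\ell$ on $E_\ell$. Let $\varphi_2^{\ell,1},\varphi_2^{\ell,2},\dots$ be a basis of $V_{{\rm snap},2}^{(\ell)}$ consisting of eigenfunctions of $$\int_{\omega_\ell}\kappa^{-1}\mathcal H_\ell(\varphi)\cdot\mathcal H_\ell(v)\,dx=\sigma\int_{\omega_\ell}\kappa^{-1}\varphi\cdot v\,dx\quad\forall v\in V_{{\rm snap},2}^{(\ell)},$$ with eigenvalues in ascending order. Let $V_{\rm sms}^{(\ell)}$ be the span of the first $\mathcal J_{\ell,2}$ of them, and let $\tilde V_{\rm sms}^{(\ell)}$ be its $a$-orthogonal complement in $V_{{\rm snap},2}^{(\ell)}$. Let $V_{{\rm snap},1}$, $V_{\rm sms}$, $\tilde V_{\rm sms}$ be the direct sums over $\ell$ of the local spaces, and let $\tilde\pi_{\rm sms}:V_{\rm snap}\to\tilde V_{\rm sms}$ be the projection belonging to $V_{\rm snap}=V_{{\rm snap},1}\oplus V_{\rm sms}\oplus\tilde V_{\rm sms}$. Let $\{\varphi_j^{(\ell)}\}_j$ be the basis of $V_{{\rm snap},1}^{(\ell)}\oplus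 V_{\rm sms}^{(\ell)}$ consisting of the unit-flux function and of the selected eigenfunctions. Global and localized spaces. Let $\tilde\psi_j^{(\ell)}\in\tilde V_{\rm sms}$ satisfy $a(\tilde\psi_j^{(\ell)},v)=-a(\varphi_j^{(\ell)},v)$ for all $v\in\tilde V_{\rm sms}$, and let $V_{\rm glo}=\operatorname{span}\{\tilde\psi_j^{(\ell)}+\varphi_j^{(\ell)}\}$. For $\tau>0$ put $\tilde\psi_j^{(\ell),0}=0$ and, for $i\ge1$, $$\tilde\psi_j^{(\ell),i}=\tilde\psi_j^{(\ell),i-1}+\tau\sum_{s:\,\omega_s\subset\omega_\ell^{+,i}}\eta^{i,s},$$ where $\eta^{i,s}\in\tilde V_{\rm sms}^{(s)}$ satisfies $a(\eta^{i,s},v)=-a(\tilde\psi_j^{(\ell),i-1}+\varphi_j^{(\ell)},v)$ for all $v\in\tilde V_{\rm sms}^{(s)}$, and where $\omega^{+,0}=\omega$ and $\omega^{+,i}=\bigcup\{K\in\mathcal T^H:K\cap\omega^{+,i-1}\ne\emptyset\}$. For $k\in\mathbb N$ (the number of iterations) let $V_{\rm ms}=\operatorname{span}\{\tilde\psi_j^{(\ell),k}+\varphi_j^{(\ell)}\}$.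 Let $A$ be the matrix of $a$ on $\tilde V_{\rm sms}=\bigoplus_\ell\tilde V_{\rm sms}^{(\ell)}$ in a basis composed of bases of the $\tilde V_{\rm sms}^{(\ell)}$, let $A_{\rm pre}$ be its block-diagonal part, and let $\mu_{\min}$ and $\mu_{\max}$ be the smallest and the largest eigenvalue of $A_{\rm pre}^{-1}A$. Statement. Let $(u_{\rm glo},p_{\rm glo})\in V_{\rm glo}\times Q_H$ solve $$a(u_{\rm glo},v)-b(v,p_{\rm glo})=0\quad\forall v\in V_{\rm glo},\qquad b(u_{\rm glo},q)=\int_D fq\,dx\quad\forall q\in Q_H,$$ and let $(u_{\rm ms},p_{\rm ms})\in V_{\rm ms}\times Q_H$ solve the same system with $V_{\rm ms}$ in place of $V_{\rm glo}$. If $0<\tau\le2(\mu_{\min}+\mu_{\max})^{-1}$, then $\theta:=\tau(\mu_{\min}+\mu_{\max})/2\in(0,1]$ and $$\|u_{\rm glo}-u_{\rm ms}\|_a\le\exp\Bigl(-\frac{k\,\theta\,\mu_{\min}}{\mu_{\max}}\Bigr)\,\|(I-\tilde\pi_{\rm sms})u_{\rm glo}\|_a .$$ -/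

import Mathlib

open MeasureTheory
open scoped ContDiff

noncomputable section

namespace MixedCEM

/-- Points (and vectors) of `ℝᵈ` with the Euclidean norm. -/
abbrev Pt (d : ℕ) : Type := EuclideanSpace ℝ (Fin d)

/-- Square integrable vector fields on `D`. -/
abbrev VecL2 {d : ℕ} (D : Set (Pt d)) : Type := Lp (Pt d) 2 ((volume : Measure (Pt d)).restrict D)

/-- The space `Q = L²(D)`. -/
abbrev ScaL2 {d : ℕ} (D : Set (Pt d)) : Type := Lp ℝ 2 ((volume : Measure (Pt d)).restrict D)

/-! ### Meshes -/

/-- A partition of (the closure of) `D` into finitely many convex polytopes with non-empty,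
pairwise disjoint interiors.  (Conformity is not needed.) -/
structure PolytopalMesh {d : ℕ} (D : Set (Pt d)) where
  /-- number of elements -/
  N : ℕ
  /-- the (closed) elements -/
  elem : Fin N → Set (Pt d)
  isPolytope : ∀ i, ∃ s : Finset (Pt d), elem i = convexHull ℝ (s : Set (Pt d))
  nonempty_interior : ∀ i, (interior (elem i)).Nonempty
  disjoint_interior : ∀ i j, i ≠ j → Disjoint (interior (elem i)) (interior (elem j))
  domain_eq : D = interior (⋃ i, elem i)

/-- The `(d-1)`-dimensional surface measure on `ℝᵈ` (normalised Hausdorff measure). -/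
def surf (d : ℕ) : Measure (Pt d) := μHE[d - 1]

namespace PolytopalMesh

variable {d : ℕ} {D : Set (Pt d)}

/-- The interior faces of a mesh: pairs of distinct elements meeting in a set of positive
surface measure. -/
abbrev Face (T : PolytopalMesh D) : Type :=
  {e : Fin T.N × Fin T.N // e.1 < e.2 ∧ surf d (T.elem e.1 ∩ T.elem e.2) ≠ 0}

instance (T : PolytopalMesh D) : Fintype T.Face := Fintype.ofFinite _

/-- The face as a subset of `ℝᵈ`. -/
def faceSet (T : PolytopalMesh D) (e : T.Face) : Set (Pt d) :=
  T.elem e.1.1 ∩ T.elem e.1.2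

end PolytopalMesh

/-- A coarse mesh, a fine mesh refining it, and a fixed unit normal for every coarse face. -/
structure TwoGrid {d : ℕ} (D : Set (Pt d)) where
  coarse : PolytopalMesh D
  fine : PolytopalMesh D
  refines : ∀ a, ∃ i, fine.elem a ⊆ coarse.elem i
  /-- the unit normal `m_ℓ` of `E_ℓ` -/
  normal : coarse.Face → Pt d
  norm_normal : ∀ l, ‖normal l‖ = 1
  normal_orthogonal : ∀ l, ∀ x ∈ coarse.faceSet l, ∀ y ∈ coarse.faceSet l,
    inner ℝ (normal l) (x - y) = 0

/-! ### The function spaces and bilinear forms -/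

section Forms

variable {d : ℕ} {D : Set (Pt d)}

/-- Smooth test functions supported in `U`. -/
def IsTest (U : Set (Pt d)) (φ : Pt d → ℝ) : Prop :=
  ContDiff ℝ ∞ φ ∧ HasCompactSupport φ ∧ tsupport φ ⊆ U

/-- `g` is the weak divergence of `u` in `D`. -/
def HasWeakDiv (u : VecL2 D) (g : ScaL2 D) : Prop :=
  ∀ φ, IsTest D φ → ∫ x in D, fderiv ℝ φ x (u x) = - ∫ x in D, g x * φ x

/-- `V = H(div; D)`. -/
def Hdiv (D : Set (Pt d)) : Set (VecL2 D) := {u | ∃ g, HasWeakDiv u g}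

/-- The weak divergence (unique, for `u ∈ H(div; D)`). -/
def weakDiv (u : VecL2 D) : ScaL2 D := Classical.epsilon (HasWeakDiv u)

/-- `V₀`: the fields in `H(div; D)` whose normal trace on `∂D` vanishes. -/
def Hdiv0 (D : Set (Pt d)) : Set (VecL2 D) :=
  {u | u ∈ Hdiv D ∧ ∀ φ, IsTest Set.univ φ →
    ∫ x in D, fderiv ℝ φ x (u x) = - ∫ x in D, weakDiv u x * φ x}

/-- `∫_S κ⁻¹ v · w dx`. -/
def aOn (κ : Pt d → ℝ) (S : Set (Pt d)) (v w : VecL2 D) : ℝ :=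
  ∫ x in S, (κ x)⁻¹ * inner ℝ (v x) (w x)

/-- `a(v, w) = ∫_D κ⁻¹ v · w dx`. -/
def aForm (κ : Pt d → ℝ) (v w : VecL2 D) : ℝ := aOn κ D v w

/-- `‖v‖_a = a(v, v)^{1/2}`. -/
def aNorm (κ : Pt d → ℝ) (v : VecL2 D) : ℝ := Real.sqrt (aForm κ v v)

/-- `b(w, q) = ∫_D q ∇·w dx`. -/
def bForm (w : VecL2 D) (q : ScaL2 D) : ℝ := ∫ x in D, q x * weakDiv w x

/-- `Q_H`: mean-zero functions that are constant on every element. -/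
def QH (T : PolytopalMesh D) : Set (ScaL2 D) :=
  {q | ∫ x in D, q x = 0 ∧
    ∀ i, ∃ c : ℝ, ∀ᵐ x ∂((volume : Measure (Pt d)).restrict (T.elem i)), q x = c}

/-- `(u, p) ∈ W × Q_H` solves the mixed Galerkin system with velocity space `W`. -/
def IsMixedSolution (T : PolytopalMesh D) (κ : Pt d → ℝ) (f : ScaL2 D)
    (W : Submodule ℝ (VecL2 D)) (u : VecL2 D) (p : ScaL2 D) : Prop :=
  u ∈ W ∧ p ∈ QH T ∧ (∀ v ∈ W, aForm κ u v - bForm v p = 0) ∧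
    ∀ q ∈ QH T, bForm u q = ∫ x in D, f x * q x

/-- The `η ∈ W` with `a(η, v) = - a(g, v)` for all `v ∈ W`. -/
def aCorrector (κ : Pt d → ℝ) (W : Submodule ℝ (VecL2 D)) (g : VecL2 D) : VecL2 D :=
  Classical.epsilon fun η => η ∈ W ∧ ∀ v ∈ W, aForm κ η v = - aForm κ g v

end Forms

namespace TwoGrid

variable {d : ℕ} {D : Set (Pt d)}

/-- The coarse face `E_ℓ` as a set. -/
def E (G : TwoGrid D) (l : G.coarse.Face) : Set (Pt d) := G.coarse.faceSet l

/-- The coarse neighbourhood `ω_ℓ`, the union of the coarse elements containing `E_ℓ`. -/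
def omega (G : TwoGrid D) (l : G.coarse.Face) : Set (Pt d) :=
  ⋃ i ∈ {i | G.E l ⊆ G.coarse.elem i}, G.coarse.elem i

/-- The oversampling region `ω^{+,k}`. -/
def oversample (G : TwoGrid D) (S : Set (Pt d)) : ℕ → Set (Pt d)
  | 0 => S
  | k + 1 => ⋃ i ∈ {i | (oversample G S k ∩ G.coarse.elem i).Nonempty}, G.coarse.elem i

/-- The fine faces lying on the coarse face `E_ℓ`. -/
abbrev FineFace (G : TwoGrid D) (l : G.coarse.Face) : Type :=
  {e : G.fine.Face // G.fine.faceSet e ⊆ G.E l}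

/-- `δ_j^ℓ`: the function equal to `|e_j|⁻¹` on the fine face `e_j` and to zero on the others. -/
def delta (G : TwoGrid D) (l : G.coarse.Face) (j : G.FineFace l) : Pt d → ℝ :=
  (G.fine.faceSet j.1).indicator fun _ => ((surf d (G.fine.faceSet j.1)).toReal)⁻¹

open Classical in
/-- `+1` if `m_ℓ` points out of the coarse element `K_i ⊆ ω_ℓ`, and `-1` if it points into it. -/
def sgn (G : TwoGrid D) (l : G.coarse.Face) (i : Fin G.coarse.N) : ℝ :=
  if ∀ x ∈ G.coarse.elem i, ∀ y ∈ G.E l, inner ℝ (G.normal l) (x - y) ≤ 0 then 1 else -1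

/-- Weak form (Green's formula, tested in `U`) of: for both elements `K ⊆ ω_ℓ`,
`u · m_ℓ = g` on `E_ℓ ∩ U` and `u · n = 0` on `(∂K \ E_ℓ) ∩ U`. -/
def HasNormalTraceIn (G : TwoGrid D) (l : G.coarse.Face) (U : Set (Pt d)) (u : VecL2 D)
    (g : Pt d → ℝ) : Prop :=
  ∀ i, G.coarse.elem i ⊆ G.omega l → ∀ φ, IsTest U φ →
    ∫ x in G.coarse.elem i, (fderiv ℝ φ x (u x) + weakDiv u x * φ x)
      = G.sgn l i * ∫ x in G.E l, g x * φ x ∂(surf d)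

/-- `u · m_ℓ = g` on `E_ℓ` and `u · n_ℓ = 0` on `∂ω_ℓ \ E_ℓ`. -/
def HasFlux (G : TwoGrid D) (l : G.coarse.Face) (u : VecL2 D) (g : Pt d → ℝ) : Prop :=
  G.HasNormalTraceIn l Set.univ u g

/-- `v = w` on `E_ℓ`, in the sense of normal traces (the only traces that fields in `H(div)`
have). The interior of `ω_ℓ` meets no face of an element `K ⊆ ω_ℓ` other than `E_ℓ`. -/
def SameTrace (G : TwoGrid D) (l : G.coarse.Face) (v w : VecL2 D) : Prop :=
  G.HasNormalTraceIn l (interior (G.omega l)) (v - w) 0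

/-- `p ∈ Q₀(ω_ℓ)` (extended by zero): zero mean on every `K ⊆ ω_ℓ`. -/
def IsLocalPressure (G : TwoGrid D) (l : G.coarse.Face) (p : ScaL2 D) : Prop :=
  (∀ᵐ x ∂((volume : Measure (Pt d)).restrict (D \ G.omega l)), p x = 0) ∧
    ∀ i, G.coarse.elem i ⊆ G.omega l → ∫ x in G.coarse.elem i, p x = 0

/-- `(ψ, p)` is the snapshot pair of the fine face `e_j ⊆ E_ℓ` (extended by zero to `D`):
`κ⁻¹ ψ + ∇p = 0` and `∇·ψ = α_K` in every `K ⊆ ω_ℓ`, `ψ·m_ℓ = δ_j^ℓ` on `E_ℓ`, `ψ·n_ℓ = 0` on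
`∂ω_ℓ \ E_ℓ`. The constant `α_K` is the one for which the divergence theorem holds on `K`. -/
def IsSnapshot (G : TwoGrid D) (κ : Pt d → ℝ) (l : G.coarse.Face) (j : G.FineFace l)
    (ψ : VecL2 D) (p : ScaL2 D) : Prop :=
  ψ ∈ Hdiv0 D ∧
  (∀ᵐ x ∂((volume : Measure (Pt d)).restrict (D \ G.omega l)), ψ x = 0) ∧
  G.IsLocalPressure l p ∧
  (∀ i, G.coarse.elem i ⊆ G.omega l → ∀ φ, IsTest (interior (G.coarse.elem i)) φ →
    ∀ y : Pt d, ∫ x in G.coarse.elem i, (κ x)⁻¹ * inner ℝ (ψ x) y * φ x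
      = ∫ x in G.coarse.elem i, p x * fderiv ℝ φ x y) ∧
  (∀ i, G.coarse.elem i ⊆ G.omega l →
    ∀ᵐ x ∂((volume : Measure (Pt d)).restrict (G.coarse.elem i)),
      weakDiv ψ x = G.sgn l i * (volume (G.coarse.elem i)).toReal⁻¹ *
        ∫ y in G.E l, G.delta l j y ∂(surf d)) ∧
  G.HasFlux l ψ (G.delta l j)

/-! ### Snapshot, offline and multiscale spaces

Below, `ψ` is the family of velocity snapshots, `φ₂` the family of eigenfunctions of the local
spectral problems, and `J l` the number of eigenfunctions that are kept on the face `E_l`. -/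

/-- `V_snap^{(ℓ)}`. -/
def VsnapLoc (G : TwoGrid D) (ψ : ∀ l, G.FineFace l → VecL2 D) (l : G.coarse.Face) :
    Submodule ℝ (VecL2 D) := Submodule.span ℝ (Set.range (ψ l))

/-- `V_snap`. -/
def Vsnap (G : TwoGrid D) (ψ : ∀ l, G.FineFace l → VecL2 D) : Submodule ℝ (VecL2 D) :=
  ⨆ l, G.VsnapLoc ψ l

/-- The elements of `V_snap^{(ℓ)}` with `φ · m_ℓ = 1` on `E_ℓ`. -/
def unitFlux (G : TwoGrid D) (ψ : ∀ l, G.FineFace l → VecL2 D) (l : G.coarse.Face) :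
    Set (VecL2 D) := {v | v ∈ G.VsnapLoc ψ l ∧ G.HasFlux l v fun _ => 1}

/-- `V_{snap,1}^{(ℓ)}`. -/
def Vsnap1Loc (G : TwoGrid D) (ψ : ∀ l, G.FineFace l → VecL2 D) (l : G.coarse.Face) :
    Submodule ℝ (VecL2 D) := Submodule.span ℝ (G.unitFlux ψ l)

/-- `V_{snap,2}^{(ℓ)}`: zero average normal flux on `E_ℓ`. -/
def Vsnap2Loc (G : TwoGrid D) (ψ : ∀ l, G.FineFace l → VecL2 D) (l : G.coarse.Face) :
    Submodule ℝ (VecL2 D) :=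
  Submodule.span ℝ {v | v ∈ G.VsnapLoc ψ l ∧
    ∃ g : Pt d → ℝ, IntegrableOn g (G.E l) (surf d) ∧ G.HasFlux l v g ∧
      ∫ x in G.E l, g x ∂(surf d) = 0}

/-- `w ∈ V_snap` has the normal trace of `v` on `E_ℓ`, and its restriction to `ω_ℓ` has minimal
energy among the restrictions to `ω_ℓ` of all such fields. -/
def IsMinExt (G : TwoGrid D) (κ : Pt d → ℝ) (ψ : ∀ l, G.FineFace l → VecL2 D)
    (l : G.coarse.Face) (v w : VecL2 D) : Prop :=
  (w ∈ G.Vsnap ψ ∧ G.SameTrace l w v) ∧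
    ∀ w' ∈ G.Vsnap ψ, G.SameTrace l w' v → aOn κ (G.omega l) w w ≤ aOn κ (G.omega l) w' w'

/-- `𝓗_ℓ(v)`, which is to be used on `ω_ℓ` only (there it is uniquely determined). -/
def minExt (G : TwoGrid D) (κ : Pt d → ℝ) (ψ : ∀ l, G.FineFace l → VecL2 D)
    (l : G.coarse.Face) (v : VecL2 D) : VecL2 D :=
  Classical.epsilon (G.IsMinExt κ ψ l v)

/-- `φ₂` is a basis of `V_{snap,2}^{(ℓ)}` consisting of eigenfunctions of the local spectral
problem `∫_{ω_ℓ} κ⁻¹ 𝓗_ℓ(φ)·𝓗_ℓ(v) = σ ∫_{ω_ℓ} κ⁻¹ φ·v`, in ascending order of the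
eigenvalues. -/
def IsEigenbasis (G : TwoGrid D) (κ : Pt d → ℝ) (ψ : ∀ l, G.FineFace l → VecL2 D)
    (l : G.coarse.Face) {n : ℕ} (φ₂ : Fin n → VecL2 D) (σ : Fin n → ℝ) : Prop :=
  LinearIndependent ℝ φ₂ ∧ Submodule.span ℝ (Set.range φ₂) = G.Vsnap2Loc ψ l ∧ Monotone σ ∧
    ∀ j, ∀ v ∈ G.Vsnap2Loc ψ l,
      aOn κ (G.omega l) (G.minExt κ ψ l (φ₂ j)) (G.minExt κ ψ l v)
        = σ j * aOn κ (G.omega l) (φ₂ j) v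

section Offline

variable (G : TwoGrid D) (κ : Pt d → ℝ) (ψ : ∀ l, G.FineFace l → VecL2 D)
  {n : G.coarse.Face → ℕ} (φ₂ : ∀ l, Fin (n l) → VecL2 D) (J : G.coarse.Face → ℕ)

/-- The first `J l` eigenfunctions. -/
def kept (l : G.coarse.Face) : Set (VecL2 D) := {v | ∃ j : Fin (n l), j.val < J l ∧ v = φ₂ l j}

/-- `V_sms^{(ℓ)}`. -/
def VsmsLoc (l : G.coarse.Face) : Submodule ℝ (VecL2 D) := Submodule.span ℝ (G.kept φ₂ J l)

/-- `Ṽ_sms^{(ℓ)}`: the `a`-orthogonal complement of `V_sms^{(ℓ)}` in `V_{snap,2}^{(ℓ)}`.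
(The set is already a subspace.) -/
def tVsmsLoc (l : G.coarse.Face) : Submodule ℝ (VecL2 D) :=
  Submodule.span ℝ {v | v ∈ G.Vsnap2Loc ψ l ∧ ∀ w ∈ G.VsmsLoc φ₂ J l, aForm κ w v = 0}

/-- `Ṽ_sms`. -/
def tVsms : Submodule ℝ (VecL2 D) := ⨆ l, G.tVsmsLoc κ ψ φ₂ J l

/-- `V_{snap,1} ⊕ V_sms`. -/
def Vmain : Submodule ℝ (VecL2 D) := (⨆ l, G.Vsnap1Loc ψ l) ⊔ ⨆ l, G.VsmsLoc φ₂ J l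

/-- The basis functions `φ_j^{(ℓ)}` of `V_{snap,1}^{(ℓ)} ⊕ V_sms^{(ℓ)}`. -/
def offlineBasis (l : G.coarse.Face) : Set (VecL2 D) := G.unitFlux ψ l ∪ G.kept φ₂ J l

/-- The projection `π̃_sms : V_snap → Ṽ_sms` along `V_{snap,1} ⊕ V_sms`: the component `z ∈ Ṽ_sms`
of `v` in the decomposition `V_snap = (V_{snap,1} ⊕ V_sms) ⊕ Ṽ_sms`. -/
def tPiSms (v : VecL2 D) : VecL2 D :=
  Classical.epsilon fun z => z ∈ G.tVsms κ ψ φ₂ J ∧ v - z ∈ G.Vmain ψ φ₂ J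

/-- `V_glo`, the span of `ψ̃_{ms,j}^{(ℓ)} + φ_j^{(ℓ)}`, where `ψ̃_{ms,j}^{(ℓ)} ∈ Ṽ_sms` solves
`a(ψ̃_{ms,j}^{(ℓ)}, v) = - a(φ_j^{(ℓ)}, v)` for all `v ∈ Ṽ_sms`. -/
def Vglo : Submodule ℝ (VecL2 D) :=
  Submodule.span ℝ {v | ∃ l, ∃ φ ∈ G.offlineBasis ψ φ₂ J l,
    v = aCorrector κ (G.tVsms κ ψ φ₂ J) φ + φ}

open Classical in
/-- The iterates `ψ̃_{ms,j}^{(ℓ),k}` for the basis function `φ = φ_j^{(ℓ)}`: start with `0`; in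
step `k` add `τ ∑ η^{k,s}` over all `s` with `ω_s ⊆ ω_ℓ^{+,k}`, where `η^{k,s} ∈ Ṽ_sms^{(s)}` solves
`a(η^{k,s}, v) = - a(ψ̃_{ms,j}^{(ℓ),k-1} + φ, v)` for all `v ∈ Ṽ_sms^{(s)}`. -/
def iterate (τ : ℝ) (l : G.coarse.Face) (φ : VecL2 D) : ℕ → VecL2 D
  | 0 => 0
  | k + 1 => iterate τ l φ k + τ • ∑ s : G.coarse.Face,
      if G.omega s ⊆ G.oversample (G.omega l) (k + 1) then
        aCorrector κ (G.tVsmsLoc κ ψ φ₂ J s) (iterate τ l φ k + φ) else 0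

/-- `V_ms`, the span of `ψ̃_{ms,j}^{(ℓ),k} + φ_j^{(ℓ)}`. -/
def Vms (τ : ℝ) (k : ℕ) : Submodule ℝ (VecL2 D) :=
  Submodule.span ℝ {v | ∃ l, ∃ φ ∈ G.offlineBasis ψ φ₂ J l,
    v = G.iterate κ ψ φ₂ J τ l φ k + φ}

/-! ### The matrices -/

variable {M : G.coarse.Face → ℕ}
  (θ : ∀ l, Module.Basis (Fin (M l)) ℝ (G.tVsmsLoc κ ψ φ₂ J l))

/-- The matrix `A` of `a(·,·)` on `Ṽ_sms`, in the basis formed by bases of the `Ṽ_sms^{(ℓ)}`. -/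
def stiffness : Matrix (Σ l : G.coarse.Face, Fin (M l)) (Σ l : G.coarse.Face, Fin (M l)) ℝ :=
  Matrix.of fun r c => aForm κ (θ c.1 c.2 : VecL2 D) (θ r.1 r.2 : VecL2 D)

/-- The block diagonal part `A_pre` of `A`. -/
def precond : Matrix (Σ l : G.coarse.Face, Fin (M l)) (Σ l : G.coarse.Face, Fin (M l)) ℝ :=
  Matrix.of fun r c => if r.1 = c.1 then G.stiffness κ ψ φ₂ J θ r c else 0

/-- The set of eigenvalues of `A_pre⁻¹ A`. -/
def precondEigenvalues : Set ℝ :=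
  {μ | Module.End.HasEigenvalue
    (Matrix.toLin' ((G.precond κ ψ φ₂ J θ)⁻¹ * G.stiffness κ ψ φ₂ J θ)) μ}

end Offline

end TwoGrid

end MixedCEM

end

open MixedCEM

/-! Localization costs nothing: a local correction left out of the iteration would have been zero.
The residual after `k` steps is supported in $\omega_\ell^{+,k}$, and an omitted $\omega_s$ meets
that patch only in a null set (`iterate_eq_schwarz`). Write $P$ for the $a$-orthogonal projection
onto $\tilde V_{sms}$ and $S_k$ for `k` steps of damped additive Schwarz on all of $\tilde V_{sms}$,
started at zero. Then $V_{glo}$ and $V_{ms}$ are the images of the same space $V_{snap,1}+V_{sms}$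
under $I-P$ and $I+S_k$ (`Vglo_eq_map`, `Vms_eq_map`), and $S_k$ approximates $-P$.

By Green's formula, fields in $\tilde V_{sms}$ are $b$-orthogonal to $Q_H$ (`Vsnap2Loc_le_divFree`),
and $u_{glo}$ is $a$-orthogonal to them. Hence $u_{glo}$ satisfies the first mixed equation also on
$V_{ms}$. Decompose $u_{glo}=z+g$ with $z=\tilde\pi_{sms}u_{glo}$. The competitor $g+S_kg\in V_{ms}$
has the same $b$-data as $u_{ms}$, so Galerkin orthogonality bounds the error by $\|z-S_kg\|_a$.

This is a Schwarz error with initial value $z$. In block coordinates one step is $1-\tau T$ with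
$T=A_{pre}^{-1}A$, which is self-adjoint for the block-diagonal form and whose energy is the
$a$-energy of the assembled field. The spectral theorem gives the factor $1-\tau\mu_{min}$ per step
(`energy_sub_smul_sum_projection_le`). Finally $\|z\|_a\le\|g\|_a$ because $z+g$ is orthogonal to
$z$, and $1-x\le e^{-x}$ gives the stated rate. -/

namespace MixedCEM

/-! ### Symmetric positive definite forms -/

section LinearAlgebra

variable {V : Type*} [AddCommGroup V] [Module ℝ V]

/-- A form which is symmetric and positive definite. -/
structure IsEnergyForm (B : V →ₗ[ℝ] V →ₗ[ℝ] ℝ) : Prop where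
  symm : ∀ x y, B x y = B y x
  pos : ∀ x, x ≠ 0 → 0 < B x x

namespace IsEnergyForm

variable {B : V →ₗ[ℝ] V →ₗ[ℝ] ℝ}

theorem nonneg (hB : IsEnergyForm B) (x : V) : 0 ≤ B x x := by
  by_cases h : x = 0
  · simp [h]
  · exact (hB.pos x h).le

theorem eq_zero (hB : IsEnergyForm B) {x : V} (h : B x x = 0) : x = 0 := by
  by_contra hx
  exact (hB.pos x hx).ne' h

theorem eq_of_forall_mem (hB : IsEnergyForm B) {W : Submodule ℝ V} {x y : V} (hx : x ∈ W)
    (hy : y ∈ W) (h : ∀ v ∈ W, B x v = B y v) : x = y := by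
  rw [← sub_eq_zero]
  apply hB.eq_zero
  have := h (x - y) (W.sub_mem hx hy)
  rw [map_sub B x y, LinearMap.sub_apply, this, sub_self]

/-- The orthogonal projection onto a finite dimensional subspace. -/
theorem exists_projection (hB : IsEnergyForm B) (W : Submodule ℝ V) [FiniteDimensional ℝ W] :
    ∃ C : V →ₗ[ℝ] V, (∀ g, C g ∈ W) ∧ ∀ g, ∀ v ∈ W, B (C g) v = B g v := by
  let R : V →ₗ[ℝ] Module.Dual ℝ W := (LinearMap.lcomp ℝ ℝ W.subtype).comp B
  let L : W →ₗ[ℝ] Module.Dual ℝ W := R.comp W.subtype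
  have hinj : Function.Injective L := by
    rw [← LinearMap.ker_eq_bot, LinearMap.ker_eq_bot']
    intro w hw
    have : B w w = 0 := LinearMap.congr_fun hw w
    exact Subtype.ext (hB.eq_zero this)
  -- Riesz representation on `W`: definiteness gives injectivity into the dual, and equal dimensions
  -- give bijectivity.
  let e := LinearEquiv.ofInjectiveOfFinrankEq L hinj (Subspace.dual_finrank_eq).symm
  refine ⟨W.subtype.comp (e.symm.toLinearMap.comp R), fun g => (e.symm (R g)).2, ?_⟩
  intro g v hv
  have h : L (e.symm (R g)) = R g := e.apply_symm_apply (R g)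
  exact LinearMap.congr_fun h ⟨v, hv⟩

/-- If the eigenvalues of a self-adjoint `T` lie in `[m, M]` and `τ (m + M) ≤ 2`, then `1 - τ T`
contracts the energy of `T` by the factor `1 - τ m`. -/
theorem energy_sub_smul_le [FiniteDimensional ℝ V] (hB : IsEnergyForm B) (T : V →ₗ[ℝ] V)
    (hT : ∀ x y, B (T x) y = B x (T y)) {m M τ : ℝ} (hm : 0 ≤ m) (hτ0 : 0 ≤ τ)
    (hτ : τ * (m + M) ≤ 2) (hE : ∀ μ, Module.End.HasEigenvalue T μ → m ≤ μ ∧ μ ≤ M) (x : V) :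
    B (T (x - τ • T x)) (x - τ • T x) ≤ (1 - τ * m) ^ 2 * B (T x) x := by
  -- With `B` as the inner product, `T` is symmetric and has an orthonormal eigenbasis, in which the
  -- claim is checked mode by mode.
  let core : InnerProductSpace.Core ℝ V :=
    { inner := fun x y => B x y
      conj_inner_symm := fun x y => by simpa using hB.symm y x
      re_inner_nonneg := fun x => by simpa using hB.nonneg x
      add_left := fun x y z => by simp
      smul_left := fun x y r => by simp
      definite := fun x h => hB.eq_zero h }
  let _ : NormedAddCommGroup V := core.toNormedAddCommGroup
  let _ : InnerProductSpace ℝ V := InnerProductSpace.ofCore core.toCore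
  have hsym : T.IsSymmetric := fun x y => hT x y
  let b := hsym.eigenvectorBasis rfl
  let ev := hsym.eigenvalues rfl
  have hTb : ∀ i, T (b i) = ev i • b i := hsym.apply_eigenvectorBasis rfl
  have hev : ∀ i, m ≤ ev i ∧ ev i ≤ M := fun i => hE _ (hsym.hasEigenvalue_eigenvalues rfl i)
  have key : ∀ y : V, B (T y) y = ∑ i, ev i * (B (b i) y) ^ 2 := by
    intro y
    have h1 : B (T y) y = ∑ i, B (T y) (b i) * B (b i) y :=
      (b.sum_inner_mul_inner (T y) y).symm
    rw [h1]
    refine Finset.sum_congr rfl fun i _ => ?_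
    rw [hT, hTb, map_smul, smul_eq_mul, hB.symm y (b i)]
    ring
  have hcoef : ∀ i, B (b i) (x - τ • T x) = (1 - τ * ev i) * B (b i) x := by
    intro i
    rw [map_sub, map_smul, ← hT, hTb, map_smul, LinearMap.smul_apply, smul_eq_mul, smul_eq_mul]
    ring
  rw [key, key, Finset.mul_sum]
  refine Finset.sum_le_sum fun i _ => ?_
  rw [hcoef, mul_pow]
  obtain ⟨h1, h2⟩ := hev i
  have h3 : τ * m ≤ τ * ev i := by gcongr
  have h4 : τ * ev i ≤ τ * M := by gcongr
  -- The lower bound `-(1 - τ m) ≤ 1 - τ ev` is where `τ (m + M) ≤ 2` enters.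
  have h5 : (1 - τ * ev i) ^ 2 ≤ (1 - τ * m) ^ 2 := sq_le_sq' (by linarith) (by linarith)
  have h6 : 0 ≤ ev i * B (b i) x ^ 2 := mul_nonneg (hm.trans h1) (sq_nonneg _)
  calc _ = (1 - τ * ev i) ^ 2 * (ev i * B (b i) x ^ 2) := by ring
    _ ≤ _ := by gcongr

end IsEnergyForm

/-! ### Block coordinates and the block Jacobi preconditioner -/

section BlockJacobi

variable {ι : Type*} {N : ι → ℕ} {W : ι → Submodule ℝ V}

/-- The matrix of `B` in a family of bases of the subspaces `W l`. -/
noncomputable def gramMatrix (B : V →ₗ[ℝ] V →ₗ[ℝ] ℝ) (b : ∀ l, Module.Basis (Fin (N l)) ℝ (W l)) :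
    Matrix (Σ l, Fin (N l)) (Σ l, Fin (N l)) ℝ :=
  Matrix.of fun r c => B (b c.1 c.2 : V) (b r.1 r.2 : V)

/-- The block diagonal part of `gramMatrix`. -/
noncomputable def gramBlocks [DecidableEq ι] (B : V →ₗ[ℝ] V →ₗ[ℝ] ℝ) (b : ∀ l, Module.Basis (Fin (N l)) ℝ (W l)) :
    Matrix (Σ l, Fin (N l)) (Σ l, Fin (N l)) ℝ :=
  Matrix.of fun r c => if r.1 = c.1 then gramMatrix B b r c else 0

/-- The component in `W l` with given coordinates. -/
noncomputable def blockVector (b : ∀ l, Module.Basis (Fin (N l)) ℝ (W l)) (l : ι) :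
    ((Σ l, Fin (N l)) → ℝ) →ₗ[ℝ] V :=
  ∑ j, (LinearMap.proj (R := ℝ) (φ := fun _ : Σ l, Fin (N l) => ℝ) ⟨l, j⟩).smulRight (b l j : V)

variable (b : ∀ l, Module.Basis (Fin (N l)) ℝ (W l))

theorem blockVector_apply (l : ι) (x : (Σ l, Fin (N l)) → ℝ) :
    blockVector b l x = ∑ j, x ⟨l, j⟩ • (b l j : V) := by
  simp [blockVector, LinearMap.sum_apply]

theorem blockVector_eq_coe (l : ι) (x : (Σ l, Fin (N l)) → ℝ) :
    blockVector b l x = ((b l).equivFun.symm fun j => x ⟨l, j⟩ : W l) := by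
  simp [blockVector_apply, Module.Basis.equivFun_symm_apply]

theorem blockVector_mem (l : ι) (x : (Σ l, Fin (N l)) → ℝ) : blockVector b l x ∈ W l := by
  rw [blockVector_eq_coe]
  exact Subtype.mem _

variable [Fintype ι]

/-- Only surjectivity of the assembly map is needed; the sum of the `W l` need not be direct. -/
theorem exists_sum_blockVector {e : V} (he : e ∈ ⨆ l, W l) :
    ∃ x, ∑ l, blockVector b l x = e := by
  obtain ⟨f, hf⟩ := (Submodule.mem_iSup_iff_exists_finsupp W e).1 he
  refine ⟨fun r => (b r.1).equivFun ⟨f r.1, hf.1 r.1⟩ r.2, ?_⟩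
  refine Eq.trans ?_ ((Finsupp.sum_fintype f (fun _ v => v) fun _ => rfl).symm.trans hf.2)
  refine Finset.sum_congr rfl fun l _ => ?_
  rw [blockVector_eq_coe]
  exact congrArg Subtype.val ((b l).equivFun.symm_apply_apply ⟨f l, hf.1 l⟩)

variable (B : V →ₗ[ℝ] V →ₗ[ℝ] ℝ)

theorem gramMatrix_mulVec (x : (Σ l, Fin (N l)) → ℝ) (r : Σ l, Fin (N l)) :
    (gramMatrix B b).mulVec x r = B (∑ l, blockVector b l x) (b r.1 r.2) := by
  simp only [Matrix.mulVec, dotProduct, gramMatrix, Matrix.of_apply, Fintype.sum_sigma,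
    blockVector_apply, map_sum, LinearMap.sum_apply, map_smul, LinearMap.smul_apply, smul_eq_mul]
  simp only [mul_comm]

theorem gramBlocks_mulVec [DecidableEq ι] (x : (Σ l, Fin (N l)) → ℝ) (r : Σ l, Fin (N l)) :
    (gramBlocks B b).mulVec x r = B (blockVector b r.1 x) (b r.1 r.2) := by
  simp only [Matrix.mulVec, dotProduct, gramBlocks, gramMatrix, Matrix.of_apply,
    Fintype.sum_sigma, blockVector_apply, map_sum, LinearMap.sum_apply, map_smul,
    LinearMap.smul_apply, smul_eq_mul]
  rw [Finset.sum_eq_single r.1]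
  · simp [mul_comm]
  · intro l _ hl
    simp [hl.symm]
  · simp

/-- The block diagonal form in coordinates. -/
noncomputable def blockForm : ((Σ l, Fin (N l)) → ℝ) →ₗ[ℝ] ((Σ l, Fin (N l)) → ℝ) →ₗ[ℝ] ℝ :=
  ∑ l, B.compl₁₂ (blockVector b l) (blockVector b l)

theorem blockForm_apply (x y : (Σ l, Fin (N l)) → ℝ) :
    blockForm b B x y = ∑ l, B (blockVector b l x) (blockVector b l y) := by
  simp [blockForm, LinearMap.sum_apply]

theorem blockForm_eq [DecidableEq ι] (x y : (Σ l, Fin (N l)) → ℝ) :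
    blockForm b B x y = ∑ r, (gramBlocks B b).mulVec x r * y r := by
  simp only [blockForm_apply, gramBlocks_mulVec, Fintype.sum_sigma]
  refine Finset.sum_congr rfl fun l _ => ?_
  rw [blockVector_apply b l y, map_sum]
  simp [mul_comm]

theorem apply_sum_blockVector (x y : (Σ l, Fin (N l)) → ℝ) :
    B (∑ l, blockVector b l x) (∑ l, blockVector b l y)
      = ∑ r, (gramMatrix B b).mulVec x r * y r := by
  simp only [gramMatrix_mulVec, Fintype.sum_sigma]
  rw [map_sum]
  refine Finset.sum_congr rfl fun l _ => ?_
  rw [blockVector_apply b l y, map_sum]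
  simp [mul_comm]

variable {B}

/-- Zero block energy makes every block vanish separately, and each local basis is independent. Thus
the form is definite on coordinates even if the assembly map has a kernel. -/
theorem isEnergyForm_blockForm (hB : IsEnergyForm B) : IsEnergyForm (blockForm b B) where
  symm x y := by
    simp only [blockForm_apply]
    exact Finset.sum_congr rfl fun l _ => hB.symm _ _
  pos x hx := by
    rw [blockForm_apply]
    refine (Finset.sum_nonneg fun l _ => hB.nonneg _).lt_of_ne' fun h => hx ?_
    rw [Finset.sum_eq_zero_iff_of_nonneg fun l _ => hB.nonneg _] at h
    funext r
    have h1 := hB.eq_zero (h r.1 (Finset.mem_univ _))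
    rw [blockVector_eq_coe, Submodule.coe_eq_zero, LinearEquiv.map_eq_zero_iff] at h1
    exact congrFun h1 r.2

variable [DecidableEq ι]

/-- Definiteness of the block form makes the block diagonal matrix invertible, so that the matrix
inverse is a genuine one. -/
theorem gramBlocks_mulVec_inv (hB : IsEnergyForm B) (x : (Σ l, Fin (N l)) → ℝ) :
    (gramBlocks B b).mulVec (((gramBlocks B b)⁻¹ * gramMatrix B b).mulVec x)
      = (gramMatrix B b).mulVec x := by
  have hu : IsUnit (gramBlocks B b) := by
    rw [← Matrix.mulVec_injective_iff_isUnit]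
    rw [← Matrix.coe_mulVecLin, ← LinearMap.ker_eq_bot, LinearMap.ker_eq_bot']
    intro y hy
    refine (isEnergyForm_blockForm b hB).eq_zero ?_
    rw [blockForm_eq]
    rw [Matrix.mulVecLin_apply] at hy
    simp [hy]
  rw [Matrix.mulVec_mulVec, ← Matrix.mul_assoc,
    Matrix.mul_nonsing_inv _ ((Matrix.isUnit_iff_isUnit_det _).1 hu), Matrix.one_mul]

/-- Cancelling the preconditioner shows that the preconditioned operator is self-adjoint for the
block form, with the energy of the assembled vector as its energy. -/
theorem blockForm_inv_mul (hB : IsEnergyForm B) (x y : (Σ l, Fin (N l)) → ℝ) :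
    blockForm b B (Matrix.toLin' ((gramBlocks B b)⁻¹ * gramMatrix B b) x) y
      = B (∑ l, blockVector b l x) (∑ l, blockVector b l y) := by
  rw [Matrix.toLin'_apply, blockForm_eq, gramBlocks_mulVec_inv b hB, apply_sum_blockVector]

/-- Tested with the `l`-th local basis, both sides give the same rows of the Gram matrix applied to
`x`. This identifies the additive Schwarz operator with the preconditioned matrix. -/
theorem projection_sum_blockVector (hB : IsEnergyForm B) {C : ι → V →ₗ[ℝ] V}
    (hC : ∀ l g, C l g ∈ W l) (hCB : ∀ l g, ∀ v ∈ W l, B (C l g) v = B g v) (l : ι)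
    (x : (Σ l, Fin (N l)) → ℝ) :
    C l (∑ l, blockVector b l x)
      = blockVector b l (Matrix.toLin' ((gramBlocks B b)⁻¹ * gramMatrix B b) x) := by
  refine hB.eq_of_forall_mem (hC l _) (blockVector_mem b l _) fun v hv => ?_
  rw [hCB l _ v hv]
  have h : (B (∑ l, blockVector b l x)).comp (W l).subtype
      = (B (blockVector b l (Matrix.toLin' ((gramBlocks B b)⁻¹ * gramMatrix B b) x))).comp
        (W l).subtype := by
    refine (b l).ext fun j => ?_
    have h1 := congrFun (gramBlocks_mulVec_inv b hB x) ⟨l, j⟩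
    rw [gramBlocks_mulVec, gramMatrix_mulVec] at h1
    exact h1.symm
  exact LinearMap.congr_fun h ⟨v, hv⟩

/-- The eigenvalue is a Rayleigh quotient: nonnegative energy over positive block energy. -/
theorem nonneg_of_hasEigenvalue (hB : IsEnergyForm B) {μ : ℝ}
    (h : Module.End.HasEigenvalue
      (Matrix.toLin' ((gramBlocks B b)⁻¹ * gramMatrix B b)) μ) : 0 ≤ μ := by
  obtain ⟨x, hx⟩ := h.exists_hasEigenvector
  have h1 := blockForm_inv_mul b hB x x
  rw [hx.apply_eq_smul, map_smul, LinearMap.smul_apply, smul_eq_mul] at h1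
  have h2 := (isEnergyForm_blockForm b hB).pos x hx.2
  refine nonneg_of_mul_nonneg_left (h1 ▸ hB.nonneg _) h2

/-- One step of the damped additive Schwarz iteration contracts the energy. -/
theorem energy_sub_smul_sum_projection_le (hB : IsEnergyForm B) {C : ι → V →ₗ[ℝ] V}
    (hC : ∀ l g, C l g ∈ W l) (hCB : ∀ l g, ∀ v ∈ W l, B (C l g) v = B g v) {m M τ : ℝ}
    (hm : IsLeast {μ | Module.End.HasEigenvalue
      (Matrix.toLin' ((gramBlocks B b)⁻¹ * gramMatrix B b)) μ} m)
    (hM : IsGreatest {μ | Module.End.HasEigenvalue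
      (Matrix.toLin' ((gramBlocks B b)⁻¹ * gramMatrix B b)) μ} M)
    (hτ0 : 0 ≤ τ) (hτ : τ * (m + M) ≤ 2) {e : V} (he : e ∈ ⨆ l, W l) :
    B (e - τ • ∑ l, C l e) (e - τ • ∑ l, C l e) ≤ (1 - τ * m) ^ 2 * B e e := by
  obtain ⟨x, rfl⟩ := exists_sum_blockVector b he
  have hBb := isEnergyForm_blockForm b hB
  set T := Matrix.toLin' ((gramBlocks B b)⁻¹ * gramMatrix B b) with hTdef
  have h1 : ∑ l, blockVector b l x - τ • ∑ l, C l (∑ l, blockVector b l x)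
      = ∑ l, blockVector b l (x - τ • T x) := by
    simp only [projection_sum_blockVector b hB hC hCB, map_sub, map_smul, Finset.sum_sub_distrib,
      Finset.smul_sum, hTdef]
  have hT : ∀ x y, blockForm b B (T x) y = blockForm b B x (T y) := fun x y => by
    rw [hBb.symm x, blockForm_inv_mul b hB, blockForm_inv_mul b hB, hB.symm]
  rw [h1, ← blockForm_inv_mul b hB, ← blockForm_inv_mul b hB x x]
  exact hBb.energy_sub_smul_le T hT (nonneg_of_hasEigenvalue b hB hm.1) hτ0 hτ
    (fun μ hμ => ⟨hm.2 hμ, hM.2 hμ⟩) x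

end BlockJacobi

end LinearAlgebra

end MixedCEM

namespace MixedCEM

/-! ### The weighted energy form on square integrable fields -/

section Energy

variable {d : ℕ} {D : Set (Pt d)} {κ : Pt d → ℝ}

/-- `κ` is measurable and bounded from below and above by positive constants. -/
structure IsCoefficient (D : Set (Pt d)) (κ : Pt d → ℝ) : Prop where
  aemeasurable : AEMeasurable κ (volume.restrict D)
  bounds : ∃ c > 0, ∀ᵐ x ∂((volume : Measure (Pt d)).restrict D), c ≤ κ x

theorem IsCoefficient.integrable (hκ : IsCoefficient D κ) (v w : VecL2 D) :
    Integrable (fun x => (κ x)⁻¹ * inner ℝ (v x) (w x)) (volume.restrict D) := by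
  obtain ⟨c, hc, h⟩ := hκ.bounds
  refine (L2.integrable_inner (𝕜 := ℝ) v w).bdd_mul (c := c⁻¹)
    hκ.aemeasurable.inv.aestronglyMeasurable ?_
  filter_upwards [h] with x hx
  rw [Real.norm_eq_abs, abs_of_pos (inv_pos.2 (hc.trans_le hx))]
  gcongr

/-- `a(·,·)` as a bilinear form. -/
noncomputable def energyForm (hκ : IsCoefficient D κ) : VecL2 D →ₗ[ℝ] VecL2 D →ₗ[ℝ] ℝ :=
  LinearMap.mk₂ ℝ (aForm κ)
    (fun u v w => by
      rw [aForm, aForm, aForm, aOn, aOn, aOn,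
        ← integral_add (hκ.integrable u w) (hκ.integrable v w)]
      refine integral_congr_ae ?_
      filter_upwards [Lp.coeFn_add u v] with x hx
      rw [hx, Pi.add_apply, inner_add_left, mul_add])
    (fun r v w => by
      rw [aForm, aForm, aOn, aOn, smul_eq_mul, ← integral_const_mul]
      refine integral_congr_ae ?_
      filter_upwards [Lp.coeFn_smul r v] with x hx
      rw [hx, Pi.smul_apply, real_inner_smul_left, mul_left_comm])
    (fun u v w => by
      rw [aForm, aForm, aForm, aOn, aOn, aOn,
        ← integral_add (hκ.integrable u v) (hκ.integrable u w)]
      refine integral_congr_ae ?_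
      filter_upwards [Lp.coeFn_add v w] with x hx
      rw [hx, Pi.add_apply, inner_add_right, mul_add])
    (fun r v w => by
      rw [aForm, aForm, aOn, aOn, smul_eq_mul, ← integral_const_mul]
      refine integral_congr_ae ?_
      filter_upwards [Lp.coeFn_smul r w] with x hx
      rw [hx, Pi.smul_apply, real_inner_smul_right, mul_left_comm])

@[simp] theorem energyForm_apply (hκ : IsCoefficient D κ) (v w : VecL2 D) :
    energyForm hκ v w = aForm κ v w := rfl

/-- The weight `κ⁻¹` is positive almost everywhere, so a field of zero energy vanishes almost
everywhere. -/
theorem isEnergyForm_energyForm (hκ : IsCoefficient D κ) : IsEnergyForm (energyForm hκ) where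
  symm v w := by
    simp only [energyForm_apply, aForm, aOn, real_inner_comm]
  pos v hv := by
    obtain ⟨c, hc, h⟩ := hκ.bounds
    have h0 : 0 ≤ᵐ[volume.restrict D] fun x => (κ x)⁻¹ * inner ℝ (v x) (v x) := by
      filter_upwards [h] with x hx
      exact mul_nonneg (inv_pos.2 (hc.trans_le hx)).le real_inner_self_nonneg
    refine (integral_nonneg_of_ae h0).lt_of_ne' fun hz => hv ?_
    have h1 := (integral_eq_zero_iff_of_nonneg_ae h0 (hκ.integrable v v)).1 hz
    rw [Lp.eq_zero_iff_ae_eq_zero]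
    filter_upwards [h1, h] with x hx1 hx
    simpa [(hc.trans_le hx).ne'] using hx1

/-- The corrector is minus the orthogonal projection. -/
theorem aCorrector_eq_neg (hκ : IsCoefficient D κ) {W : Submodule ℝ (VecL2 D)}
    {C : VecL2 D →ₗ[ℝ] VecL2 D} (hC : ∀ g, C g ∈ W)
    (hCB : ∀ g, ∀ v ∈ W, energyForm hκ (C g) v = energyForm hκ g v) (g : VecL2 D) :
    aCorrector κ W g = -C g := by
  -- The choice operator is meaningful only once a solution is exhibited; uniqueness then identifies
  -- the chosen one.
  have hex : ∃ η, η ∈ W ∧ ∀ v ∈ W, aForm κ η v = - aForm κ g v := by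
    refine ⟨-C g, W.neg_mem (hC g), fun v hv => ?_⟩
    have := hCB g v hv
    rw [← energyForm_apply hκ, ← energyForm_apply hκ, map_neg, LinearMap.neg_apply, this]
  have h := Classical.epsilon_spec hex
  refine (isEnergyForm_energyForm hκ).eq_of_forall_mem h.1 (W.neg_mem (hC g)) fun v hv => ?_
  rw [map_neg, LinearMap.neg_apply, hCB g v hv]
  exact h.2 v hv

end Energy

end MixedCEM

namespace MixedCEM

/-! ### Measure theory of polytopal meshes -/

namespace PolytopalMesh

variable {d : ℕ} {D : Set (Pt d)}

theorem convex_elem (T : PolytopalMesh D) (i : Fin T.N) : Convex ℝ (T.elem i) := by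
  obtain ⟨s, hs⟩ := T.isPolytope i
  rw [hs]
  exact convex_convexHull ℝ _

theorem isCompact_elem (T : PolytopalMesh D) (i : Fin T.N) : IsCompact (T.elem i) := by
  obtain ⟨s, hs⟩ := T.isPolytope i
  rw [hs]
  exact s.finite_toSet.isCompact_convexHull ℝ

theorem isClosed_biUnion_elem (T : PolytopalMesh D) (I : Set (Fin T.N)) : IsClosed (⋃ i ∈ I, T.elem i) :=
  I.toFinite.isClosed_biUnion fun i _ => (T.isCompact_elem i).isClosed

theorem isOpen_domain (T : PolytopalMesh D) : IsOpen D := by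
  rw [T.domain_eq]
  exact isOpen_interior

theorem domain_subset (T : PolytopalMesh D) : D ⊆ ⋃ i, T.elem i := by
  conv_lhs => rw [T.domain_eq]
  exact interior_subset

theorem isCompact_iUnion_elem (T : PolytopalMesh D) : IsCompact (⋃ i, T.elem i) :=
  isCompact_iUnion T.isCompact_elem

theorem interior_elem_subset (T : PolytopalMesh D) (i : Fin T.N) : interior (T.elem i) ⊆ D := by
  conv_rhs => rw [T.domain_eq]
  exact interior_mono (Set.subset_iUnion T.elem i)

theorem isFiniteMeasure_restrict (T : PolytopalMesh D) : IsFiniteMeasure ((volume : Measure (Pt d)).restrict D) where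
  measure_univ_lt_top := by
    rw [Measure.restrict_apply_univ]
    exact (measure_mono T.domain_subset).trans_lt T.isCompact_iUnion_elem.measure_lt_top

/-- Points of an element outside the open set `D` lie on the element's frontier, which is null by
convexity. -/
theorem volume_elem_diff (T : PolytopalMesh D) (i : Fin T.N) : volume (T.elem i \ D) = 0 := by
  refine measure_mono_null ?_ ((T.convex_elem i).addHaar_frontier volume)
  intro x hx
  exact ⟨subset_closure hx.1, fun h => hx.2 (T.interior_elem_subset i h)⟩

theorem restrict_elem_le (T : PolytopalMesh D) (i : Fin T.N) :
    (volume : Measure (Pt d)).restrict (T.elem i) ≤ volume.restrict D :=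
  Measure.restrict_mono_ae (ae_le_set.2 (T.volume_elem_diff i))

/-- A common point cannot be interior to both elements, so it lies on one of two null frontiers. -/
theorem volume_elem_inter (T : PolytopalMesh D) {i j : Fin T.N} (h : i ≠ j) :
    volume (T.elem i ∩ T.elem j) = 0 := by
  refine measure_mono_null ?_ (measure_union_null
    ((T.convex_elem i).addHaar_frontier volume) ((T.convex_elem j).addHaar_frontier volume))
  intro x hx
  by_cases hi : x ∈ interior (T.elem i)
  · exact Or.inr ⟨subset_closure hx.2,
      fun hj => Set.disjoint_left.1 (T.disjoint_interior i j h) hi hj⟩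
  · exact Or.inl ⟨subset_closure hx.1, hi⟩

theorem volume_biUnion_inter_biUnion (T : PolytopalMesh D) {I I' : Set (Fin T.N)} (h : Disjoint I I') :
    volume ((⋃ i ∈ I, T.elem i) ∩ ⋃ i ∈ I', T.elem i) = 0 := by
  simp only [Set.iUnion_inter, Set.inter_iUnion]
  refine measure_iUnion_null fun i => measure_iUnion_null fun hi =>
    measure_iUnion_null fun j => measure_iUnion_null fun hj => ?_
  exact T.volume_elem_inter (h.ne_of_mem hj hi)

theorem integral_domain_eq_sum (T : PolytopalMesh D) {g : Pt d → ℝ} (hg : IntegrableOn g D) :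
    ∫ x in D, g x = ∑ i, ∫ x in T.elem i, g x := by
  have hae : D =ᵐ[volume] ⋃ i, T.elem i := by
    refine Filter.EventuallyLE.antisymm T.domain_subset.eventuallyLE (ae_le_set.2 ?_)
    rw [Set.iUnion_sdiff]
    exact measure_iUnion_null T.volume_elem_diff
  rw [setIntegral_congr_set hae, integral_iUnion_ae, tsum_fintype]
  · exact fun i => (T.isCompact_elem i).measurableSet.nullMeasurableSet
  · exact fun i j hij => T.volume_elem_inter hij
  · exact hg.congr_set_ae hae.symm

/-- A cut-off function which is one near all elements. -/
theorem exists_cutoff (T : PolytopalMesh D) : ∃ φ : Pt d → ℝ, IsTest Set.univ φ ∧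
    ∀ i, ∀ x ∈ T.elem i, φ x = 1 ∧ fderiv ℝ φ x = 0 := by
  obtain ⟨R, hR⟩ := T.isCompact_iUnion_elem.isBounded.subset_ball 0
  have hR' : 0 < max R 1 := by positivity
  -- The maximum with `1` keeps the inner radius positive even if `R` is not.
  let b : ContDiffBump (0 : Pt d) := ⟨max R 1, max R 1 + 1, hR', by linarith⟩
  refine ⟨b, ⟨b.contDiff, b.hasCompactSupport, Set.subset_univ _⟩, fun i x hx => ?_⟩
  have hx' : x ∈ Metric.ball (0 : Pt d) b.rIn :=
    Metric.ball_subset_ball (le_max_left _ _) (hR (Set.mem_iUnion_of_mem i hx))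
  have h1 := b.eventuallyEq_one_of_mem_ball hx'
  exact ⟨h1.eq_of_nhds, by rw [h1.fderiv_eq]; simp⟩

end PolytopalMesh

/-! ### Weak divergence -/

section WeakDiv

variable {d : ℕ} {D : Set (Pt d)}

theorem IsTest.integrable_mul {φ : Pt d → ℝ} {U : Set (Pt d)} (hφ : IsTest U φ) (g : ScaL2 D) :
    Integrable (fun x => g x * φ x) (volume.restrict D) := by
  have h : MemLp φ 2 ((volume : Measure (Pt d)).restrict D) :=
    (hφ.1.continuous.memLp_of_hasCompactSupport hφ.2.1).restrict D
  exact (Lp.memLp g).integrable_mul h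

theorem IsTest.integrable_fderiv {φ : Pt d → ℝ} {U : Set (Pt d)} (hφ : IsTest U φ)
    [IsFiniteMeasure ((volume : Measure (Pt d)).restrict D)] (u : VecL2 D) :
    Integrable (fun x => fderiv ℝ φ x (u x)) (volume.restrict D) := by
  have hc : Continuous (fderiv ℝ φ) := hφ.1.continuous_fderiv (by simp)
  obtain ⟨C, hC⟩ := hc.bounded_above_of_compact_support (hφ.2.1.fderiv (𝕜 := ℝ))
  have hu : Integrable u (volume.restrict D) := (Lp.memLp u).integrable one_le_two
  refine (hu.norm.const_mul C).mono' ?_ (Filter.Eventually.of_forall fun x => ?_)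
  · exact isBoundedBilinearMap_apply.continuous.comp_aestronglyMeasurable
      (hc.aestronglyMeasurable.prodMk hu.aestronglyMeasurable)
  · exact (ContinuousLinearMap.le_opNorm _ _).trans (by gcongr; exact hC x)

/-- The fundamental lemma of the calculus of variations, used for uniqueness of the weak divergence
and for its locality. -/
theorem ae_eq_zero_of_forall_isTest {U : Set (Pt d)} (hU : IsOpen U) {g : ScaL2 D}
    (h : ∀ φ, IsTest U φ → ∫ x in D, g x * φ x = 0) :
    ∀ᵐ x ∂((volume : Measure (Pt d)).restrict D), x ∈ U → g x = 0 := by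
  refine hU.ae_eq_zero_of_integral_contDiff_smul_eq_zero
    (((Lp.memLp g).locallyIntegrable one_le_two).locallyIntegrableOn U) fun φ h1 h2 h3 => ?_
  simpa only [smul_eq_mul, mul_comm] using h φ ⟨h1, h2, h3⟩

/-- Uniqueness makes the chosen `weakDiv` linear on $H(\mathrm{div})$. -/
theorem HasWeakDiv.unique (T : PolytopalMesh D) {u : VecL2 D} {g g' : ScaL2 D}
    (h : HasWeakDiv u g) (h' : HasWeakDiv u g') : g = g' := by
  rw [← sub_eq_zero, Lp.eq_zero_iff_ae_eq_zero]
  have key := ae_eq_zero_of_forall_isTest T.isOpen_domain (g := g - g') fun φ hφ => ?_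
  · filter_upwards [key, ae_restrict_mem T.isOpen_domain.measurableSet] with x hx hxD
    exact hx hxD
  have h1 : ∫ x in D, (g - g') x * φ x = ∫ x in D, (g x * φ x - g' x * φ x) := by
    refine integral_congr_ae ?_
    filter_upwards [Lp.coeFn_sub g g'] with x hx
    rw [hx, Pi.sub_apply, sub_mul]
  rw [h1, integral_sub (hφ.integrable_mul g) (hφ.integrable_mul g')]
  linarith [h φ hφ, h' φ hφ]

theorem hasWeakDiv_weakDiv {u : VecL2 D} (hu : u ∈ Hdiv D) : HasWeakDiv u (weakDiv u) :=
  Classical.epsilon_spec hu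

theorem HasWeakDiv.add (T : PolytopalMesh D) {u v : VecL2 D} {g h : ScaL2 D}
    (hu : HasWeakDiv u g) (hv : HasWeakDiv v h) : HasWeakDiv (u + v) (g + h) := by
  intro φ hφ
  have := T.isFiniteMeasure_restrict
  have h1 : ∫ x in D, fderiv ℝ φ x ((u + v) x)
      = ∫ x in D, (fderiv ℝ φ x (u x) + fderiv ℝ φ x (v x)) := by
    refine integral_congr_ae ?_
    filter_upwards [Lp.coeFn_add u v] with x hx
    rw [hx, Pi.add_apply, map_add]
  have h2 : ∫ x in D, (g + h) x * φ x = ∫ x in D, (g x * φ x + h x * φ x) := by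
    refine integral_congr_ae ?_
    filter_upwards [Lp.coeFn_add g h] with x hx
    rw [hx, Pi.add_apply, add_mul]
  rw [h1, h2, integral_add (hφ.integrable_fderiv u) (hφ.integrable_fderiv v),
    integral_add (hφ.integrable_mul g) (hφ.integrable_mul h), hu φ hφ, hv φ hφ, neg_add]

theorem HasWeakDiv.smul {u : VecL2 D} {g : ScaL2 D} (c : ℝ) (hu : HasWeakDiv u g) :
    HasWeakDiv (c • u) (c • g) := by
  intro φ hφ
  have h1 : ∫ x in D, fderiv ℝ φ x ((c • u) x) = ∫ x in D, c * fderiv ℝ φ x (u x) := by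
    refine integral_congr_ae ?_
    filter_upwards [Lp.coeFn_smul c u] with x hx
    rw [hx, Pi.smul_apply, map_smul, smul_eq_mul]
  have h2 : ∫ x in D, (c • g) x * φ x = ∫ x in D, c * (g x * φ x) := by
    refine integral_congr_ae ?_
    filter_upwards [Lp.coeFn_smul c g] with x hx
    rw [hx, Pi.smul_apply, smul_eq_mul, mul_assoc]
  rw [h1, h2, integral_const_mul, integral_const_mul, hu φ hφ, mul_neg]

theorem HasWeakDiv.zero : HasWeakDiv (0 : VecL2 D) 0 := by
  intro φ _
  rw [integral_eq_zero_of_ae, integral_eq_zero_of_ae, neg_zero]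
  · filter_upwards [Lp.coeFn_zero ℝ 2 ((volume : Measure (Pt d)).restrict D)] with x hx
    rw [hx, Pi.zero_apply, zero_mul]
  · filter_upwards [Lp.coeFn_zero (Pt d) 2 ((volume : Measure (Pt d)).restrict D)] with x hx
    rw [hx, Pi.zero_apply, map_zero]
    rfl

/-- `H(div; D)` as a subspace. -/
def hdivSubmodule (T : PolytopalMesh D) : Submodule ℝ (VecL2 D) where
  carrier := Hdiv D
  add_mem' := fun ⟨g, hg⟩ ⟨h, hh⟩ => ⟨g + h, hg.add T hh⟩
  zero_mem' := ⟨0, HasWeakDiv.zero⟩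
  smul_mem' := fun c _ ⟨g, hg⟩ => ⟨c • g, hg.smul c⟩

theorem weakDiv_add (T : PolytopalMesh D) {u v : VecL2 D} (hu : u ∈ Hdiv D) (hv : v ∈ Hdiv D) :
    weakDiv (u + v) = weakDiv u + weakDiv v :=
  (hasWeakDiv_weakDiv ((hdivSubmodule T).add_mem hu hv)).unique T
    ((hasWeakDiv_weakDiv hu).add T (hasWeakDiv_weakDiv hv))

theorem weakDiv_smul (T : PolytopalMesh D) {u : VecL2 D} (c : ℝ) (hu : u ∈ Hdiv D) :
    weakDiv (c • u) = c • weakDiv u :=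
  (hasWeakDiv_weakDiv ((hdivSubmodule T).smul_mem c hu)).unique T
    ((hasWeakDiv_weakDiv hu).smul c)

theorem integrable_mul_weakDiv (u : VecL2 D) (q : ScaL2 D) :
    Integrable (fun x => q x * weakDiv u x) (volume.restrict D) :=
  (Lp.memLp q).integrable_mul (Lp.memLp (weakDiv u))

theorem bForm_add (T : PolytopalMesh D) {u v : VecL2 D} (hu : u ∈ Hdiv D) (hv : v ∈ Hdiv D)
    (q : ScaL2 D) : bForm (u + v) q = bForm u q + bForm v q := by
  rw [bForm, bForm, bForm,
    ← integral_add (integrable_mul_weakDiv u q) (integrable_mul_weakDiv v q)]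
  refine integral_congr_ae ?_
  filter_upwards [Lp.coeFn_add (weakDiv u) (weakDiv v)] with x hx
  rw [weakDiv_add T hu hv, hx, Pi.add_apply, mul_add]

theorem bForm_smul (T : PolytopalMesh D) {u : VecL2 D} (c : ℝ) (hu : u ∈ Hdiv D) (q : ScaL2 D) :
    bForm (c • u) q = c * bForm u q := by
  rw [bForm, bForm, ← integral_const_mul]
  refine integral_congr_ae ?_
  filter_upwards [Lp.coeFn_smul c (weakDiv u)] with x hx
  rw [weakDiv_smul T c hu, hx, Pi.smul_apply, smul_eq_mul, mul_left_comm]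

/-- The fields in `H(div; D)` that are `b`-orthogonal to `Q_H`. -/
def divFreeSubmodule (T : PolytopalMesh D) : Submodule ℝ (VecL2 D) where
  carrier := {v | v ∈ Hdiv D ∧ ∀ q ∈ QH T, bForm v q = 0}
  add_mem' := fun hu hv => ⟨(hdivSubmodule T).add_mem hu.1 hv.1, fun q hq => by
    rw [bForm_add T hu.1 hv.1, hu.2 q hq, hv.2 q hq, add_zero]⟩
  zero_mem' := ⟨(hdivSubmodule T).zero_mem, fun q _ => by
    rw [← zero_smul ℝ (0 : VecL2 D), bForm_smul T 0 (hdivSubmodule T).zero_mem, zero_mul]⟩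
  smul_mem' := fun c u hu => ⟨(hdivSubmodule T).smul_mem c hu.1, fun q hq => by
    rw [bForm_smul T c hu.1, hu.2 q hq, mul_zero]⟩

/-- Fields whose divergence has mean zero on every element are `b`-orthogonal to `Q_H`. -/
theorem mem_divFreeSubmodule (T : PolytopalMesh D) {v : VecL2 D} (hv : v ∈ Hdiv D)
    (h : ∀ i, ∫ x in T.elem i, weakDiv v x = 0) : v ∈ divFreeSubmodule T := by
  refine ⟨hv, fun q hq => ?_⟩
  rw [bForm, T.integral_domain_eq_sum (integrable_mul_weakDiv v q)]
  refine Finset.sum_eq_zero fun i _ => ?_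
  obtain ⟨c, hc⟩ := hq.2 i
  have h1 : ∫ x in T.elem i, q x * weakDiv v x = ∫ x in T.elem i, c * weakDiv v x := by
    refine integral_congr_ae ?_
    filter_upwards [hc] with x hx
    rw [hx]
  rw [h1, integral_const_mul, h i, mul_zero]

/-! ### Supports -/

/-- The fields that vanish almost everywhere outside `S`. -/
def supportedIn (D S : Set (Pt d)) : Submodule ℝ (VecL2 D) where
  carrier := {v | ∀ᵐ x ∂((volume : Measure (Pt d)).restrict D), x ∉ S → v x = 0}
  add_mem' := fun {u v} hu hv => by
    filter_upwards [hu, hv, Lp.coeFn_add u v] with x h1 h2 h3 hx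
    rw [h3, Pi.add_apply, h1 hx, h2 hx, add_zero]
  zero_mem' := by
    filter_upwards [Lp.coeFn_zero (Pt d) 2 ((volume : Measure (Pt d)).restrict D)] with x hx _
    rw [hx, Pi.zero_apply]
  smul_mem' := fun c v hv => by
    filter_upwards [hv, Lp.coeFn_smul c v] with x h1 h2 hx
    rw [h2, Pi.smul_apply, h1 hx, smul_zero]

theorem supportedIn_mono {S S' : Set (Pt d)} (h : S ⊆ S') :
    supportedIn D S ≤ supportedIn D S' := fun v hv => by
  filter_upwards [show ∀ᵐ x ∂_, x ∉ S → v x = 0 from hv] with x hx hxS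
  exact hx fun h' => hxS (h h')

theorem aForm_eq_zero_of_supportedIn (κ : Pt d → ℝ) {S S' : Set (Pt d)}
    (h : volume (S ∩ S') = 0) {v w : VecL2 D} (hv : v ∈ supportedIn D S)
    (hw : w ∈ supportedIn D S') : aForm κ v w = 0 := by
  refine integral_eq_zero_of_ae ?_
  filter_upwards [show ∀ᵐ x ∂_, x ∉ S → v x = 0 from hv, show ∀ᵐ x ∂_, x ∉ S' → w x = 0 from hw,
    ae_restrict_of_ae (measure_eq_zero_iff_ae_notMem.1 h)] with x h1 h2 h3
  by_cases hx : x ∈ S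
  · simp [h2 fun hx' => h3 ⟨hx, hx'⟩]
  · simp [h1 hx]

/-- The divergence of a field vanishes where the field vanishes. -/
theorem weakDiv_ae_eq_zero {S : Set (Pt d)} (hS : IsClosed S) (hD : IsOpen D)
    {v : VecL2 D} (hv : v ∈ Hdiv D)
    (hvS : v ∈ supportedIn D S) :
    ∀ᵐ x ∂((volume : Measure (Pt d)).restrict D), x ∉ S → weakDiv v x = 0 := by
  have key := ae_eq_zero_of_forall_isTest (hD.inter hS.isOpen_compl) (g := weakDiv v)
    fun φ hφ => ?_
  · filter_upwards [key, ae_restrict_mem hD.measurableSet] with x hx hxD hxS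
    exact hx ⟨hxD, hxS⟩
  have h1 := hasWeakDiv_weakDiv hv φ ⟨hφ.1, hφ.2.1, hφ.2.2.trans Set.inter_subset_left⟩
  have h2 : ∫ x in D, fderiv ℝ φ x (v x) = 0 := by
    refine integral_eq_zero_of_ae ?_
    filter_upwards [show ∀ᵐ x ∂_, x ∉ S → v x = 0 from hvS] with x hx
    by_cases hxS : x ∈ S
    · have : x ∉ tsupport φ := fun h => (hφ.2.2 h).2 hxS
      have h3 : fderiv ℝ φ x = 0 := by
        by_contra h4
        exact this (support_fderiv_subset ℝ h4)
      simp [h3]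
    · simp [hx hxS]
  linarith

end WeakDiv

end MixedCEM

namespace MixedCEM

/-! ### Damped additive Schwarz iteration -/

section Schwarz

variable {V : Type*} [AddCommGroup V] [Module ℝ V] {ι : Type*} [Fintype ι]

/-- The damped additive Schwarz iteration with subspace projections `C l`. -/
noncomputable def schwarz (C : ι → V →ₗ[ℝ] V) (τ : ℝ) : ℕ → V →ₗ[ℝ] V
  | 0 => 0
  | k + 1 => schwarz C τ k - τ • ∑ l, (C l).comp (schwarz C τ k + LinearMap.id)

theorem schwarz_succ_apply (C : ι → V →ₗ[ℝ] V) (τ : ℝ) (k : ℕ) (g : V) :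
    schwarz C τ (k + 1) g = schwarz C τ k g - τ • ∑ l, C l (schwarz C τ k g + g) := by
  simp [schwarz, LinearMap.sum_apply]

variable {W : ι → Submodule ℝ V} {C : ι → V →ₗ[ℝ] V}

theorem sum_projection_mem (hC : ∀ l g, C l g ∈ W l) (g : V) : ∑ l, C l g ∈ ⨆ l, W l :=
  Submodule.sum_mem _ fun l _ => Submodule.mem_iSup_of_mem l (hC l g)

theorem schwarz_mem (hC : ∀ l g, C l g ∈ W l) (τ : ℝ) (k : ℕ) (g : V) :
    schwarz C τ k g ∈ ⨆ l, W l := by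
  induction k with
  | zero => exact Submodule.zero_mem _
  | succ k ih =>
    rw [schwarz_succ_apply]
    exact Submodule.sub_mem _ ih (Submodule.smul_mem _ _ (sum_projection_mem hC _))

/-- The target `z` is a fixed point, since every local projection kills `z + g`. The error therefore
starts at `z`, stays in the sum of the subspaces, and undergoes one contraction per step. -/
theorem energy_sub_schwarz_le [DecidableEq ι] {B : V →ₗ[ℝ] V →ₗ[ℝ] ℝ} (hB : IsEnergyForm B)
    {N : ι → ℕ} (b : ∀ l, Module.Basis (Fin (N l)) ℝ (W l))
    (hC : ∀ l g, C l g ∈ W l) (hCB : ∀ l g, ∀ v ∈ W l, B (C l g) v = B g v) {m M τ : ℝ}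
    (hm : IsLeast {μ | Module.End.HasEigenvalue
      (Matrix.toLin' ((gramBlocks B b)⁻¹ * gramMatrix B b)) μ} m)
    (hM : IsGreatest {μ | Module.End.HasEigenvalue
      (Matrix.toLin' ((gramBlocks B b)⁻¹ * gramMatrix B b)) μ} M)
    (hτ0 : 0 ≤ τ) (hτ : τ * (m + M) ≤ 2) {z g : V} (hz : z ∈ ⨆ l, W l)
    (hzg : ∀ v ∈ ⨆ l, W l, B (z + g) v = 0) (k : ℕ) :
    B (z - schwarz C τ k g) (z - schwarz C τ k g) ≤ ((1 - τ * m) ^ k) ^ 2 * B z z := by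
  induction k with
  | zero => simp [schwarz]
  | succ k ih =>
    have h0 : ∀ l, C l (z + g) = 0 := fun l => by
      refine hB.eq_zero ?_
      rw [hCB l _ _ (hC l _)]
      exact hzg _ (Submodule.mem_iSup_of_mem l (hC l _))
    have h1 : ∀ l, C l (schwarz C τ k g + g) = -C l (z - schwarz C τ k g) := fun l => by
      rw [← sub_eq_zero, sub_neg_eq_add, ← map_add, ← h0 l]
      congr 1
      abel
    have h2 : z - schwarz C τ (k + 1) g
        = (z - schwarz C τ k g) - τ • ∑ l, C l (z - schwarz C τ k g) := by
      simp only [schwarz_succ_apply, h1, Finset.sum_neg_distrib, smul_neg]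
      abel
    rw [h2]
    refine (energy_sub_smul_sum_projection_le b hB hC hCB hm hM hτ0 hτ
      (Submodule.sub_mem _ hz (schwarz_mem hC τ k g))).trans ?_
    calc (1 - τ * m) ^ 2 * _ ≤ (1 - τ * m) ^ 2 * (((1 - τ * m) ^ k) ^ 2 * B z z) := by gcongr
      _ = ((1 - τ * m) ^ (k + 1)) ^ 2 * B z z := by ring

end Schwarz

/-! ### Geometry of neighbourhoods and oversampling regions -/

namespace TwoGrid

variable {d : ℕ} {D : Set (Pt d)} (G : TwoGrid D)

/-- A face has nonzero surface measure by definition. Its points tie together all elements of the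
neighbourhood. -/
theorem E_nonempty (l : G.coarse.Face) : (G.E l).Nonempty := by
  by_contra h
  rw [Set.not_nonempty_iff_eq_empty] at h
  refine l.2.2 ?_
  rw [show G.coarse.elem l.1.1 ∩ G.coarse.elem l.1.2 = ∅ from h, measure_empty]

/-- The set must be a union of elements: then each of its points lies in an element touching it. -/
theorem subset_oversample_succ {S : Set (Pt d)} {k : ℕ} {I : Set (Fin G.coarse.N)}
    (hI : G.oversample S k = ⋃ i ∈ I, G.coarse.elem i) :
    G.oversample S k ⊆ G.oversample S (k + 1) := by
  intro x hx
  have hx' := hx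
  rw [hI] at hx'
  simp only [Set.mem_iUnion] at hx'
  obtain ⟨i, hi, hxi⟩ := hx'
  exact Set.mem_biUnion (show i ∈ {i | (G.oversample S k ∩ G.coarse.elem i).Nonempty} from
    ⟨x, hx, hxi⟩) hxi

theorem exists_oversample_eq (l : G.coarse.Face) (k : ℕ) :
    ∃ I : Set (Fin G.coarse.N), G.oversample (G.omega l) k = ⋃ i ∈ I, G.coarse.elem i := by
  cases k with
  | zero => exact ⟨_, rfl⟩
  | succ k => exact ⟨_, rfl⟩

theorem oversample_subset_succ (l : G.coarse.Face) (k : ℕ) :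
    G.oversample (G.omega l) k ⊆ G.oversample (G.omega l) (k + 1) :=
  G.subset_oversample_succ (G.exists_oversample_eq l k).choose_spec

theorem omega_subset_oversample (l : G.coarse.Face) (k : ℕ) :
    G.omega l ⊆ G.oversample (G.omega l) k := by
  induction k with
  | zero => exact subset_rfl
  | succ k ih => exact ih.trans (G.oversample_subset_succ l k)

/-- A neighbourhood not contained in the next oversampling region misses the current one. -/
theorem volume_oversample_inter_omega (l s : G.coarse.Face) (k : ℕ)
    (h : ¬ G.omega s ⊆ G.oversample (G.omega l) (k + 1)) :
    volume (G.oversample (G.omega l) k ∩ G.omega s) = 0 := by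
  obtain ⟨I, hI⟩ := G.exists_oversample_eq l k
  rw [hI]
  refine G.coarse.volume_biUnion_inter_biUnion (Set.disjoint_left.2 fun i hi hs => h ?_)
  -- If one element of `ω_s` belongs to the current patch, then `x` lies in the patch and in every
  -- element of `ω_s`, so one more layer covers `ω_s`.
  obtain ⟨x, hx⟩ := G.E_nonempty s
  refine Set.iUnion₂_subset fun j hj => ?_
  refine Set.subset_biUnion_of_mem
    (show j ∈ {j | (G.oversample (G.omega l) k ∩ G.coarse.elem j).Nonempty} from
      ⟨x, ?_, hj hx⟩) (u := G.coarse.elem)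
  rw [hI]
  exact Set.mem_biUnion hi (hs hx)

theorem isClosed_omega (l : G.coarse.Face) : IsClosed (G.omega l) :=
  G.coarse.isClosed_biUnion_elem _

/-- An element not contained in `ω_ℓ` overlaps with it in a null set only. -/
theorem volume_elem_inter_omega (l : G.coarse.Face) (i : Fin G.coarse.N)
    (h : ¬ G.coarse.elem i ⊆ G.omega l) : volume (G.coarse.elem i ∩ G.omega l) = 0 := by
  have := G.coarse.volume_biUnion_inter_biUnion (I := {i})
    (I' := {i | G.E l ⊆ G.coarse.elem i}) (Set.disjoint_left.2 fun j hj hl => h ?_)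
  · simpa [omega] using this
  · rw [Set.mem_singleton_iff] at hj
    exact Set.subset_biUnion_of_mem (hj ▸ hl) (u := G.coarse.elem)

variable {G} {κ : Pt d → ℝ}

theorem IsSnapshot.mem_hdiv {l : G.coarse.Face} {j : G.FineFace l} {ψ : VecL2 D} {p : ScaL2 D}
    (h : G.IsSnapshot κ l j ψ p) : ψ ∈ Hdiv D := h.1.1

theorem IsSnapshot.mem_supportedIn {l : G.coarse.Face} {j : G.FineFace l} {ψ : VecL2 D}
    {p : ScaL2 D} (h : G.IsSnapshot κ l j ψ p) : ψ ∈ supportedIn D (G.omega l) := by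
  have h1 := h.2.1
  rw [Set.sdiff_eq, Set.inter_comm, ← Measure.restrict_restrict
    (G.isClosed_omega l).isOpen_compl.measurableSet,
    ae_restrict_iff' (G.isClosed_omega l).isOpen_compl.measurableSet] at h1
  exact h1

/-! ### Structure of the snapshot, global and localized spaces -/

section Spaces

variable {ψ : ∀ l, G.FineFace l → VecL2 D} {pψ : ∀ l, G.FineFace l → ScaL2 D}

theorem VsnapLoc_le_hdiv (hψ : ∀ l j, G.IsSnapshot κ l j (ψ l j) (pψ l j)) (l : G.coarse.Face) :
    G.VsnapLoc ψ l ≤ hdivSubmodule G.coarse := by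
  refine Submodule.span_le.2 ?_
  rintro _ ⟨j, rfl⟩
  exact (hψ l j).mem_hdiv

theorem VsnapLoc_le_supportedIn (hψ : ∀ l j, G.IsSnapshot κ l j (ψ l j) (pψ l j))
    (l : G.coarse.Face) : G.VsnapLoc ψ l ≤ supportedIn D (G.omega l) := by
  refine Submodule.span_le.2 ?_
  rintro _ ⟨j, rfl⟩
  exact (hψ l j).mem_supportedIn

theorem Vsnap2Loc_le_VsnapLoc (l : G.coarse.Face) : G.Vsnap2Loc ψ l ≤ G.VsnapLoc ψ l :=
  Submodule.span_le.2 fun _ hv => hv.1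

/-- Fields with zero average flux are `b`-orthogonal to `Q_H`. -/
theorem Vsnap2Loc_le_divFree (hψ : ∀ l j, G.IsSnapshot κ l j (ψ l j) (pψ l j))
    (l : G.coarse.Face) : G.Vsnap2Loc ψ l ≤ divFreeSubmodule G.coarse := by
  refine Submodule.span_le.2 ?_
  rintro v ⟨hv, g, -, hg, hg0⟩
  have hdiv : v ∈ Hdiv D := VsnapLoc_le_hdiv hψ l hv
  refine mem_divFreeSubmodule G.coarse hdiv fun i => ?_
  by_cases hi : G.coarse.elem i ⊆ G.omega l
  -- Green's formula tested with a function equal to one near the mesh: the gradient term drops out,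
  -- and the total divergence on the element is the total flux up to sign.
  · obtain ⟨φ, hφ, h1⟩ := G.coarse.exists_cutoff
    have hf := hg i hi φ hφ
    have h2 : ∫ x in G.coarse.elem i, (fderiv ℝ φ x (v x) + weakDiv v x * φ x)
        = ∫ x in G.coarse.elem i, weakDiv v x := by
      refine setIntegral_congr_fun (G.coarse.isCompact_elem i).measurableSet fun x hx => ?_
      simp [(h1 i x hx).1, (h1 i x hx).2]
    have h3 : ∫ x in G.E l, g x * φ x ∂(surf d) = ∫ x in G.E l, g x ∂(surf d) := by
      refine setIntegral_congr_fun ((G.coarse.isCompact_elem _).inter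
        (G.coarse.isCompact_elem _)).measurableSet fun x hx => ?_
      simp [(h1 _ x hx.1).1]
    rw [← h2, hf, h3, hg0, mul_zero]
  -- On an element outside `ω_l` the field vanishes, hence so does its divergence.
  · refine integral_eq_zero_of_ae ?_
    have h1 := weakDiv_ae_eq_zero (G.isClosed_omega l) G.coarse.isOpen_domain hdiv
      (VsnapLoc_le_supportedIn hψ l hv)
    filter_upwards [(G.coarse.restrict_elem_le i).absolutelyContinuous.ae_le h1,
      ae_restrict_of_ae (measure_eq_zero_iff_ae_notMem.1 (G.volume_elem_inter_omega l i hi)),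
      ae_restrict_mem (G.coarse.isCompact_elem i).measurableSet] with x hx hx1 hx2
    exact hx fun h => hx1 ⟨hx2, h⟩

variable {n : G.coarse.Face → ℕ} {φ₂ : ∀ l, Fin (n l) → VecL2 D} {J : G.coarse.Face → ℕ}

theorem tVsmsLoc_le_Vsnap2Loc (l : G.coarse.Face) : G.tVsmsLoc κ ψ φ₂ J l ≤ G.Vsnap2Loc ψ l :=
  Submodule.span_le.2 fun _ hv => hv.1

theorem tVsms_le_divFree (hψ : ∀ l j, G.IsSnapshot κ l j (ψ l j) (pψ l j)) :
    G.tVsms κ ψ φ₂ J ≤ divFreeSubmodule G.coarse :=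
  iSup_le fun l => (tVsmsLoc_le_Vsnap2Loc l).trans (Vsnap2Loc_le_divFree hψ l)

theorem tVsmsLoc_le_supportedIn (hψ : ∀ l j, G.IsSnapshot κ l j (ψ l j) (pψ l j))
    (l : G.coarse.Face) : G.tVsmsLoc κ ψ φ₂ J l ≤ supportedIn D (G.omega l) :=
  (tVsmsLoc_le_Vsnap2Loc l).trans
    ((Vsnap2Loc_le_VsnapLoc l).trans (VsnapLoc_le_supportedIn hψ l))

theorem offlineBasis_subset_VsnapLoc
    (hφ₂ : ∀ l, Submodule.span ℝ (Set.range (φ₂ l)) = G.Vsnap2Loc ψ l) (l : G.coarse.Face) :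
    G.offlineBasis ψ φ₂ J l ⊆ G.VsnapLoc ψ l := by
  rintro v (hv | ⟨j, -, rfl⟩)
  · exact hv.1
  · exact Vsnap2Loc_le_VsnapLoc l (hφ₂ l ▸ Submodule.subset_span ⟨j, rfl⟩)

/-- Both multiscale spaces are spanned by modified offline basis functions; this exhibits them as
linear images of one space. -/
theorem Vmain_eq_span :
    G.Vmain ψ φ₂ J = Submodule.span ℝ {φ | ∃ l, φ ∈ G.offlineBasis ψ φ₂ J l} := by
  have h : {φ | ∃ l, φ ∈ G.offlineBasis ψ φ₂ J l}
      = (⋃ l, G.unitFlux ψ l) ∪ ⋃ l, G.kept φ₂ J l := by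
    rw [← Set.iUnion_union_distrib]
    ext φ
    simp [offlineBasis]
  rw [h, Submodule.span_union, Submodule.span_iUnion, Submodule.span_iUnion]
  rfl

theorem Vmain_le_hdiv (hψ : ∀ l j, G.IsSnapshot κ l j (ψ l j) (pψ l j))
    (hφ₂ : ∀ l, Submodule.span ℝ (Set.range (φ₂ l)) = G.Vsnap2Loc ψ l) :
    G.Vmain ψ φ₂ J ≤ hdivSubmodule G.coarse := by
  rw [Vmain_eq_span]
  refine Submodule.span_le.2 ?_
  rintro φ ⟨l, hφ⟩
  exact VsnapLoc_le_hdiv hψ l (offlineBasis_subset_VsnapLoc hφ₂ l hφ)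

variable {C : G.coarse.Face → VecL2 D →ₗ[ℝ] VecL2 D}

/-- The localized iteration is the additive Schwarz iteration: by locality, the omitted
corrections vanish. -/
theorem iterate_eq_schwarz (hκ : IsCoefficient D κ)
    (hψ : ∀ l j, G.IsSnapshot κ l j (ψ l j) (pψ l j))
    (hC : ∀ l g, C l g ∈ G.tVsmsLoc κ ψ φ₂ J l)
    (hCB : ∀ l g, ∀ v ∈ G.tVsmsLoc κ ψ φ₂ J l, energyForm hκ (C l g) v = energyForm hκ g v)
    (τ : ℝ) {l : G.coarse.Face} {φ : VecL2 D} (hφ : φ ∈ supportedIn D (G.omega l)) (k : ℕ) :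
    G.iterate κ ψ φ₂ J τ l φ k = schwarz C τ k φ ∧
      G.iterate κ ψ φ₂ J τ l φ k ∈ supportedIn D (G.oversample (G.omega l) k) := by
  induction k with
  | zero => exact ⟨rfl, Submodule.zero_mem _⟩
  | succ k ih =>
    have hs : G.iterate κ ψ φ₂ J τ l φ k + φ ∈ supportedIn D (G.oversample (G.omega l) k) :=
      Submodule.add_mem _ ih.2 (supportedIn_mono (G.omega_subset_oversample l k) hφ)
    constructor
    · rw [iterate, schwarz_succ_apply, ← ih.1, sub_eq_add_neg, ← smul_neg,
        ← Finset.sum_neg_distrib]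
      congr 2
      refine Finset.sum_congr rfl fun s _ => ?_
      split_ifs with h
      · exact aCorrector_eq_neg hκ (hC s) (hCB s) _
      -- The omitted projection has energy `B r (C s r)`, with `r` the residual. This is zero
      -- because the supports of `r` and `C s r` overlap in a null set.
      · rw [eq_comm, neg_eq_zero]
        refine (isEnergyForm_energyForm hκ).eq_zero ?_
        rw [hCB s _ _ (hC s _)]
        exact aForm_eq_zero_of_supportedIn κ (G.volume_oversample_inter_omega l s k h) hs
          (tVsmsLoc_le_supportedIn hψ s (hC s _))
    · rw [iterate]
      refine Submodule.add_mem _ (supportedIn_mono (G.oversample_subset_succ l k) ih.2)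
        (Submodule.smul_mem _ _ (Submodule.sum_mem _ fun s _ => ?_))
      split_ifs with h
      · rw [aCorrector_eq_neg hκ (hC s) (hCB s)]
        exact Submodule.neg_mem _
          (supportedIn_mono h (tVsmsLoc_le_supportedIn hψ s (hC s _)))
      · exact Submodule.zero_mem _

theorem Vms_eq_map (hκ : IsCoefficient D κ)
    (hψ : ∀ l j, G.IsSnapshot κ l j (ψ l j) (pψ l j))
    (hφ₂ : ∀ l, Submodule.span ℝ (Set.range (φ₂ l)) = G.Vsnap2Loc ψ l)
    (hC : ∀ l g, C l g ∈ G.tVsmsLoc κ ψ φ₂ J l)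
    (hCB : ∀ l g, ∀ v ∈ G.tVsmsLoc κ ψ φ₂ J l, energyForm hκ (C l g) v = energyForm hκ g v)
    (τ : ℝ) (k : ℕ) :
    G.Vms κ ψ φ₂ J τ k = (G.Vmain ψ φ₂ J).map (schwarz C τ k + LinearMap.id) := by
  rw [Vmain_eq_span, Submodule.map_span, Vms]
  congr 1
  have key : ∀ l, ∀ φ ∈ G.offlineBasis ψ φ₂ J l,
      G.iterate κ ψ φ₂ J τ l φ k = schwarz C τ k φ := fun l φ hφ =>
    (iterate_eq_schwarz hκ hψ hC hCB τ
      (VsnapLoc_le_supportedIn hψ l (offlineBasis_subset_VsnapLoc hφ₂ l hφ)) k).1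
  ext v
  constructor
  · rintro ⟨l, φ, hφ, rfl⟩
    exact ⟨φ, ⟨l, hφ⟩, by rw [key l φ hφ]; rfl⟩
  · rintro ⟨φ, ⟨l, hφ⟩, rfl⟩
    exact ⟨l, φ, hφ, by rw [key l φ hφ]; rfl⟩

theorem Vglo_eq_map (hκ : IsCoefficient D κ) {P : VecL2 D →ₗ[ℝ] VecL2 D}
    (hP : ∀ g, P g ∈ G.tVsms κ ψ φ₂ J)
    (hPB : ∀ g, ∀ v ∈ G.tVsms κ ψ φ₂ J, energyForm hκ (P g) v = energyForm hκ g v) :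
    G.Vglo κ ψ φ₂ J = (G.Vmain ψ φ₂ J).map (LinearMap.id - P) := by
  rw [Vmain_eq_span, Submodule.map_span, Vglo]
  congr 1
  have key : ∀ φ, aCorrector κ (G.tVsms κ ψ φ₂ J) φ + φ = (LinearMap.id (R := ℝ) (M := VecL2 D) - P) φ := fun φ => by
    rw [aCorrector_eq_neg hκ hP hPB, neg_add_eq_sub]
    rfl
  ext v
  constructor
  · rintro ⟨l, φ, hφ, rfl⟩
    exact ⟨φ, ⟨l, hφ⟩, (key φ).symm⟩
  · rintro ⟨φ, ⟨l, hφ⟩, rfl⟩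
    exact ⟨l, φ, hφ, (key φ).symm⟩

end Spaces

end TwoGrid

end MixedCEM

/-! ### Abstract Galerkin estimates and the exponential rate -/

namespace MixedCEM

/-- If `z + g` is orthogonal to `z`, then `z` is no longer than `g`. -/
theorem IsEnergyForm.le_of_apply_add_eq_zero {V : Type*} [AddCommGroup V] [Module ℝ V]
    {B : V →ₗ[ℝ] V →ₗ[ℝ] ℝ} (hB : IsEnergyForm B) {z g : V} (h : B (z + g) z = 0) :
    B z z ≤ B g g := by
  have h1 := hB.nonneg (z + g)
  have h2 := hB.symm z g
  simp only [map_add, LinearMap.add_apply] at h h1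
  linarith

/-- Galerkin orthogonality implies the best approximation property. -/
theorem IsEnergyForm.sub_le_of_orthogonal {V : Type*} [AddCommGroup V] [Module ℝ V]
    {B : V →ₗ[ℝ] V →ₗ[ℝ] ℝ} (hB : IsEnergyForm B) {u w v : V} (h : B (u - w) (w - v) = 0) :
    B (u - w) (u - w) ≤ B (u - v) (u - v) := by
  have h1 : B (u - v) (u - v)
      = B (u - w) (u - w) + 2 * B (u - w) (w - v) + B (w - v) (w - v) := by
    rw [show u - v = (u - w) + (w - v) by abel]
    simp only [map_add (B _), map_add B, LinearMap.add_apply]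
    rw [hB.symm (w - v) (u - w)]
    ring
  rw [h1, h]
  linarith [hB.nonneg (w - v)]

/-- Combine `1 - x ≤ exp (-x)` at `x = τ m` with `τ (m + M) / 2 ≤ τ M`, which follows from `m ≤ M`.
-/
theorem one_sub_mul_pow_le_exp {τ m M : ℝ} (hτ0 : 0 < τ) (hm : 0 ≤ m) (hmM : m ≤ M)
    (hM : 0 < M) (h1 : 0 ≤ 1 - τ * m) (k : ℕ) :
    (1 - τ * m) ^ k ≤ Real.exp (-(k * (τ * (m + M) / 2) * m / M)) := by
  have h2 : 1 - τ * m ≤ Real.exp (-(τ * m)) := by linarith [Real.add_one_le_exp (-(τ * m))]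
  refine (pow_le_pow_left₀ h1 h2 k).trans ?_
  rw [← Real.exp_nat_mul, Real.exp_le_exp, mul_neg, neg_le_neg_iff, div_le_iff₀ hM]
  have h3 : τ * (m + M) / 2 ≤ τ * M := by nlinarith
  have h4 : 0 ≤ (k : ℝ) * m := by positivity
  nlinarith [mul_le_mul_of_nonneg_left h3 h4]

end MixedCEM

/-! ### The localization error estimate -/

theorem mainTheorem3 {d : ℕ} (hd : d = 2 ∨ d = 3) {D : Set (Pt d)} (G : TwoGrid D)
    (κ : Pt d → ℝ) (κmin κmax : ℝ)
    (hκ : AEMeasurable κ ((volume : Measure (Pt d)).restrict D)) (hκmin : 0 < κmin)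
    (hκb : ∀ᵐ x ∂((volume : Measure (Pt d)).restrict D), κmin ≤ κ x ∧ κ x ≤ κmax)
    (f : ScaL2 D) (hf : ∫ x in D, f x = 0)
    -- the snapshot pairs
    (ψ : ∀ l, G.FineFace l → VecL2 D) (pψ : ∀ l, G.FineFace l → ScaL2 D)
    (hψ : ∀ l j, G.IsSnapshot κ l j (ψ l j) (pψ l j))
    -- the eigenpairs of the local spectral problems, and the numbers of kept eigenfunctions
    {n : G.coarse.Face → ℕ} (φ₂ : ∀ l, Fin (n l) → VecL2 D) (σ : ∀ l, Fin (n l) → ℝ)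
    (hφ₂ : ∀ l, G.IsEigenbasis κ ψ l (φ₂ l) (σ l)) (J : G.coarse.Face → ℕ)
    -- the extreme eigenvalues of `A_pre⁻¹ A`
    {M : G.coarse.Face → ℕ} (θ : ∀ l, Module.Basis (Fin (M l)) ℝ (G.tVsmsLoc κ ψ φ₂ J l))
    (μmin μmax : ℝ) (hμmin : IsLeast (G.precondEigenvalues κ ψ φ₂ J θ) μmin)
    (hμmax : IsGreatest (G.precondEigenvalues κ ψ φ₂ J θ) μmax)
    -- the regularization parameter and the number of iterations
    (τ : ℝ) (hτ0 : 0 < τ) (hτ : τ ≤ 2 * (μmin + μmax)⁻¹) (k : ℕ)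
    -- the global and the localized multiscale solution
    (uglo ums : VecL2 D) (pglo pms : ScaL2 D)
    (hglo : IsMixedSolution G.coarse κ f (G.Vglo κ ψ φ₂ J) uglo pglo)
    (hms : IsMixedSolution G.coarse κ f (G.Vms κ ψ φ₂ J τ k) ums pms) :
    (0 < τ * (μmin + μmax) / 2 ∧ τ * (μmin + μmax) / 2 ≤ 1) ∧
      aNorm κ (uglo - ums) ≤
        Real.exp (-(k * (τ * (μmin + μmax) / 2) * μmin / μmax)) *
          aNorm κ (uglo - G.tPiSms κ ψ φ₂ J uglo) := by
  have hcoef : IsCoefficient D κ := ⟨hκ, κmin, hκmin, hκb.mono fun x hx => hx.1⟩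
  set B := energyForm hcoef with hBdef
  have hB : IsEnergyForm B := isEnergyForm_energyForm hcoef
  have hspan := fun l => (hφ₂ l).2.1
  -- projections onto the local spaces and onto their sum
  have hfin : ∀ l, FiniteDimensional ℝ (G.tVsmsLoc κ ψ φ₂ J l) :=
    fun l => Module.Finite.of_basis (θ l)
  choose C hC hCB using fun l => hB.exists_projection (G.tVsmsLoc κ ψ φ₂ J l)
  have hfin' : FiniteDimensional ℝ (G.tVsms κ ψ φ₂ J) := by
    rw [TwoGrid.tVsms]
    infer_instance
  obtain ⟨P, hP, hPB⟩ := hB.exists_projection (G.tVsms κ ψ φ₂ J)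
  have hVglo := TwoGrid.Vglo_eq_map (G := G) (ψ := ψ) (φ₂ := φ₂) (J := J) hcoef hP hPB
  have hVms := TwoGrid.Vms_eq_map hcoef hψ hspan hC hCB τ k
  -- the eigenvalue bounds
  have hm0 : 0 ≤ μmin := nonneg_of_hasEigenvalue θ hB hμmin.1
  have hmM : μmin ≤ μmax := hμmin.2 hμmax.1
  -- Positivity of `τ` forces the inverse to be positive, hence also the sum.
  have hsum : 0 < μmin + μmax := by
    have := hτ0.trans_le hτ
    rwa [mul_pos_iff_of_pos_left two_pos, inv_pos] at this
  have hτ2 : τ * (μmin + μmax) ≤ 2 := by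
    rwa [← div_eq_mul_inv, le_div_iff₀ hsum] at hτ
  have hM0 : 0 < μmax := by linarith
  refine ⟨⟨by positivity, by linarith⟩, ?_⟩
  -- `uglo` is `a`-orthogonal to `Ṽ_sms`
  have horth : ∀ v ∈ G.tVsms κ ψ φ₂ J, B uglo v = 0 := by
    have hu := hglo.1
    rw [hVglo] at hu
    obtain ⟨g, -, rfl⟩ := hu
    intro v hv
    rw [LinearMap.sub_apply, map_sub, LinearMap.sub_apply, hPB g v hv, LinearMap.id_apply, sub_self]
  -- the decomposition `uglo = z + g`
  obtain ⟨hz, hg⟩ : G.tPiSms κ ψ φ₂ J uglo ∈ G.tVsms κ ψ φ₂ J ∧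
      uglo - G.tPiSms κ ψ φ₂ J uglo ∈ G.Vmain ψ φ₂ J := by
    -- Membership in the two summands is all that is used of the projection, so existence suffices.
    -- It comes from writing `uglo` as `g - P g`.
    refine Classical.epsilon_spec
      (p := fun z => z ∈ G.tVsms κ ψ φ₂ J ∧ uglo - z ∈ G.Vmain ψ φ₂ J) ?_
    have hu := hglo.1
    rw [hVglo] at hu
    obtain ⟨g, hg, rfl⟩ := hu
    refine ⟨-P g, Submodule.neg_mem _ (hP g), ?_⟩
    simpa using hg
  set z := G.tPiSms κ ψ φ₂ J uglo
  set g := uglo - z with hgdef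
  have hzg : z + g = uglo := by rw [hgdef]; abel
  have hS : ∀ w, schwarz C τ k w ∈ G.tVsms κ ψ φ₂ J := fun w => schwarz_mem hC τ k w
  -- The competitor: the exact corrector of `g` is replaced by its Schwarz approximation.
  set v := schwarz C τ k g + g with hvdef
  have hv : v ∈ G.Vms κ ψ φ₂ J τ k := by
    rw [hVms]
    exact ⟨g, hg, rfl⟩
  -- `b` does not see `Ṽ_sms`
  have hb : ∀ w ∈ hdivSubmodule G.coarse, ∀ t ∈ G.tVsms κ ψ φ₂ J, ∀ q ∈ QH G.coarse,
      bForm (w + t) q = bForm w q := by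
    intro w hw t ht q hq
    have ht' := TwoGrid.tVsms_le_divFree hψ ht
    rw [bForm_add G.coarse hw ht'.1, ht'.2 q hq, add_zero]
  have hmain := TwoGrid.Vmain_le_hdiv (J := J) hψ hspan
  have htd : G.tVsms κ ψ φ₂ J ≤ hdivSubmodule G.coarse :=
    fun t ht => (TwoGrid.tVsms_le_divFree hψ ht).1
  have hmsd : G.Vms κ ψ φ₂ J τ k ≤ hdivSubmodule G.coarse := by
    rw [hVms]
    rintro _ ⟨w, hw, rfl⟩
    exact Submodule.add_mem _ (htd (hS w)) (hmain hw)
  -- A trial field of `Vms` differs from the one of `Vglo` with the same offline part by an element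
  -- of `Ṽ_sms`. Neither `a(uglo, ·)` nor `b(·, q)` with `q` in `QH` sees it.
  have hgloms : ∀ w ∈ G.Vms κ ψ φ₂ J τ k, B uglo w = bForm w pglo := by
    intro w hw
    rw [hVms] at hw
    obtain ⟨w, hw, rfl⟩ := hw
    have h1 : (schwarz C τ k + LinearMap.id (R := ℝ) (M := VecL2 D)) w = (w - P w) + (schwarz C τ k w + P w) := by
      simp only [LinearMap.add_apply, LinearMap.id_apply]
      abel
    have h2 : w - P w ∈ G.Vglo κ ψ φ₂ J := by
      rw [hVglo]
      exact ⟨w, hw, rfl⟩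
    have h3 := Submodule.add_mem _ (hS w) (hP w)
    rw [h1, map_add, horth _ h3, add_zero, hb _ (Submodule.sub_mem _ (hmain hw) (htd (hP w))) _ h3
      _ hglo.2.1]
    exact sub_eq_zero.1 (hglo.2.2.1 _ h2)
  -- The fields `ums`, `uglo` and `v` all have the same pairing with `QH`, which removes both
  -- pressures from the error equation.
  have hdivfree : ∀ q ∈ QH G.coarse, bForm (ums - v) q = 0 := by
    intro q hq
    have h1 : bForm v q = ∫ x in D, f x * q x := by
      rw [← hglo.2.2.2 q hq, hvdef, add_comm, hb _ (hmain hg) _ (hS g) q hq, ← hzg, add_comm z g,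
        hb _ (hmain hg) _ hz q hq]
    have hums := hmsd hms.1
    have h2 := hmsd hv
    have h3 := bForm_add G.coarse (u := ums - v) (v := v) (Submodule.sub_mem _ hums h2) h2 q
    rw [sub_add_cancel, h1, hms.2.2.2 q hq] at h3
    linarith
  have hgal : B (uglo - ums) (ums - v) = 0 := by
    have hw := Submodule.sub_mem _ hms.1 hv
    have h1 : B ums (ums - v) = bForm (ums - v) pms := sub_eq_zero.1 (hms.2.2.1 _ hw)
    rw [map_sub B uglo, LinearMap.sub_apply, hgloms _ hw, h1, hdivfree _ hglo.2.1,
      hdivfree _ hms.2.1, sub_zero]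
  have h1 := hB.sub_le_of_orthogonal hgal
  have h2 : uglo - v = z - schwarz C τ k g := by
    rw [hvdef, ← hzg]
    abel
  have hzg' : ∀ t ∈ G.tVsms κ ψ φ₂ J, B (z + g) t = 0 := by
    rw [hzg]
    exact horth
  have h3 := energy_sub_schwarz_le hB θ hC hCB hμmin hμmax hτ0.le hτ2 hz hzg' k
  -- This trades the initial error `z` for `g`, the field in the claimed bound.
  have h4 := hB.le_of_apply_add_eq_zero (hzg' z hz)
  -- Indeed `2 τ μmin ≤ τ (μmin + μmax) ≤ 2`.
  have hρ : 0 ≤ 1 - τ * μmin := by nlinarith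
  rw [h2] at h1
  have h5 : B (uglo - ums) (uglo - ums) ≤ ((1 - τ * μmin) ^ k) ^ 2 * B g g :=
    (h1.trans h3).trans (by gcongr)
  calc aNorm κ (uglo - ums) ≤ Real.sqrt (((1 - τ * μmin) ^ k) ^ 2 * B g g) := Real.sqrt_le_sqrt h5
    _ = (1 - τ * μmin) ^ k * aNorm κ g := by
      rw [Real.sqrt_mul (sq_nonneg _), Real.sqrt_sq (pow_nonneg hρ k)]
      rfl
    _ ≤ _ := mul_le_mul_of_nonneg_right (one_sub_mul_pow_le_exp hτ0 hm0 hmM hM0 hρ k)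
      (Real.sqrt_nonneg _)
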